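/- For $\alpha\ge 0$ and $\Omega\subset\mathbb R$, let $C^\alpha(\Omega)$ denote the space of functions on $\Omega$ that are continuously differentiable with bounded derivatives up to order $\lfloor\alpha\rfloor$ (continuous and bounded if $\lfloor\alpha\rfloor=0$) and whose derivative of order $\lfloor\alpha\rfloor$ satisfies the Hölder condition with index $\alpha-\lfloor\alpha\rfloor$ on $\Omega$. For $0<s<1$ let $$(-\Delta)^su(x):=c_s\,\mathrm{P.V.}\!\int_{\mathbb R}\frac{u(x)-u(y)}{|x-y|^{1+2s}}\,dy,\qquad c_s:=\frac{s\,4^s\,\Gamma(\frac12+s)}{\sqrt\pi\,\Gamma(1-s)}.$$ **Proposition 3.1.** Let $0<\beta<1$ and $0<2s\le 1-\beta$. There exist two functions $u\in C^{\frac{2s}{1-\beta}}(\mathbb R)$ and $f\in C^\beta(\mathbb R)$ such that $u$ is periodic, $(-\Delta)^su(x)$ is well defined and equal to $f(u(x))$ for every $x\in\mathbb R$, and $$u\notin C^{\frac{2s}{1-\beta}+\epsilon}([-\rho,\rho])\qquad\text{for all }\epsilon>0\text{ and }\rho>0.$$ -/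

import Mathlib

open Set Filter Topology MeasureTheory

/-- The Hölder class `C^α(Ω)` for `α ≥ 0` and `Ω ⊆ ℝ`: functions that are continuously
differentiable on `Ω` with bounded derivatives up to order `⌊α⌋` and whose derivative of order
`⌊α⌋` satisfies the Hölder condition with index `α - ⌊α⌋` on `Ω`. (For `⌊α⌋ = 0` the first two
clauses say that `u` is continuous and bounded on `Ω`; derivatives at an end point of an interval
are one-sided.) -/
def HolderClass (α : ℝ) (Ω : Set ℝ) (u : ℝ → ℝ) : Prop :=
  ContDiffOn ℝ (⌊α⌋₊ : ℕ) u Ω ∧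
  (∀ k : ℕ, k ≤ ⌊α⌋₊ → ∃ M : ℝ, ∀ x ∈ Ω, |iteratedDerivWithin k u Ω x| ≤ M) ∧
  ∃ C : ℝ, ∀ x ∈ Ω, ∀ y ∈ Ω,
    |iteratedDerivWithin ⌊α⌋₊ u Ω x - iteratedDerivWithin ⌊α⌋₊ u Ω y|
      ≤ C * |x - y| ^ (α - (⌊α⌋₊ : ℝ))

/-- The normalizing constant `c_s = s 4^s Γ(1/2 + s) / (√π Γ(1 - s))`. -/
noncomputable def fracLaplacianConst (s : ℝ) : ℝ :=
  s * (4 : ℝ) ^ s * Real.Gamma (1 / 2 + s) / (Real.sqrt Real.pi * Real.Gamma (1 - s))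

/-- `HasFracLaplacianAt s u x v` says that `(-Δ)^s u (x)` is well defined and equal to `v`: the
integrand `(u(x) - u(y)) / |x - y|^(1+2s)` is integrable off every neighbourhood of `x`, and the
principal value, i.e. the limit as `δ ↓ 0` of the integrals over `|x - y| > δ`, exists and, once
multiplied by `c_s`, equals `v`. -/
def HasFracLaplacianAt (s : ℝ) (u : ℝ → ℝ) (x v : ℝ) : Prop :=
  (∀ δ : ℝ, 0 < δ →
    IntegrableOn (fun y : ℝ => (u x - u y) / |x - y| ^ (1 + 2 * s)) {y : ℝ | δ < |x - y|}) ∧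
  Tendsto
    (fun δ : ℝ => fracLaplacianConst s *
      ∫ y in {y : ℝ | δ < |x - y|}, (u x - u y) / |x - y| ^ (1 + 2 * s))
    (𝓝[>] 0) (𝓝 v)

/-! Put `α = 2s/(1-β) ≤ 1` and `φ(t) = |t|^α / (1 - log |t|)`. The solution is `u(x) = φ(sin x) -
φ(cos x)`, even, `π`-periodic, and odd under `x ↦ π/2 - x`. The logarithm serves the endpoint `α =
1`: there `φ` is `C¹` with zero derivative at the origin, whereas `|t|` is not. It costs less than
any power, so `u - u(0) ≥ φ(sin x)` still excludes every exponent above `α` near the minimum `0`.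

No `f` is prescribed. It suffices that `H = fracIntegral s u` satisfies `|H x - H y| ≤ K |u x - u
y|^β`: then `H` is a function of `u`, and that function is `β`-Hölder (`exists_holderClass_factor`).

To prove this bound near the minimum, take `x ≤ y ≤ 2x` and `r = (y - x)/x`. Dilating by `x` turns
`u - u(0)` into a function of size `φ(x)` that is Lipschitz near `[1, y/x]`. A kernel splitting at
unit scale (`abs_fracIntegral_sub_le_unit`) then gives `|H x - H y| ≲ x^(-2s) φ(x) r^(1-2s)`, while
`u y - u x ≳ φ(x) r`. The first is at most a multiple of `(φ(x) r)^β` because `β ≤ 1 - 2s` and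
`φ(x)^(1-β) ≤ x^(α(1-β)) = x^(2s)`; this balance dictates `α`.

Since `u - u(0)` contracts by a fixed factor under halving, the dyadic estimates sum geometrically
down to `0` (`DyadicProfile.holder`). The symmetries of `u`, inherited by `H`, spread the bound from
`[0, π/4]` to the line. -/

/-- The kernel of the fractional Laplacian, truncated by a power vanishing at the origin, is
integrable. -/
theorem integrable_min_rpow_kernel {p q : ℝ} (hq : 0 < q) (hp : q < p) :
    Integrable (fun z : ℝ => min (|z| ^ p) 1 / |z| ^ (1 + q)) := by
  have hmeas : AEStronglyMeasurable (fun z : ℝ => min (z ^ p) 1 / z ^ (1 + q))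
      (volume.restrict (Ioi 0)) := by
    apply Measurable.aestronglyMeasurable
    fun_prop
  have hpos : IntegrableOn (fun z : ℝ => min (z ^ p) 1 / z ^ (1 + q)) (Ioi 0) := by
    rw [← Ioc_union_Ioi_eq_Ioi (zero_le_one' ℝ)]
    refine IntegrableOn.union ?_ ?_
    · have h : IntegrableOn (fun z : ℝ => z ^ (p - (1 + q))) (Ioc 0 1) :=
        (intervalIntegrable_iff_integrableOn_Ioc_of_le zero_le_one).1
          (intervalIntegral.intervalIntegrable_rpow' (by linarith))
      refine Integrable.mono' h (hmeas.mono_measure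
        (Measure.restrict_mono Ioc_subset_Ioi_self le_rfl)) ?_
      refine (ae_restrict_iff' measurableSet_Ioc).2 (ae_of_all _ fun z hz => ?_)
      have hz0 : 0 < z := hz.1
      rw [Real.norm_of_nonneg (by positivity), Real.rpow_sub hz0]
      gcongr
      exact min_le_left _ _
    · have h : IntegrableOn (fun z : ℝ => z ^ (-(1 + q))) (Ioi 1) :=
        integrableOn_Ioi_rpow_of_lt (by linarith) one_pos
      refine Integrable.mono' h (hmeas.mono_measure
        (Measure.restrict_mono (Ioi_subset_Ioi zero_le_one) le_rfl)) ?_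
      refine (ae_restrict_iff' measurableSet_Ioi).2 (ae_of_all _ fun z hz => ?_)
      have hz0 : 0 < z := lt_trans one_pos hz
      rw [Real.norm_of_nonneg (by positivity), Real.rpow_neg hz0.le, ← one_div]
      gcongr
      exact min_le_right _ _
  have habs : IntegrableOn (fun z : ℝ => min (|z| ^ p) 1 / |z| ^ (1 + q)) (Ioi 0) :=
    hpos.congr_fun (fun z hz => by simp only [abs_of_pos (mem_Ioi.1 hz)]) measurableSet_Ioi
  have hneg : IntegrableOn (fun z : ℝ => min (|z| ^ p) 1 / |z| ^ (1 + q)) (Iic 0) := by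
    have := ((integrableOn_Ici_iff_integrableOn_Ioi).2 habs).comp_neg
    simpa [abs_neg] using this
  rw [← integrableOn_univ, ← Iic_union_Ioi (a := (0 : ℝ))]
  exact hneg.union habs

/-! ### The fractional Laplacian as an absolutely convergent integral -/

/-- The integral defining `(-Δ)^s u (x)`, without the normalizing constant, as an absolutely
convergent integral. -/
noncomputable def fracIntegral (s : ℝ) (u : ℝ → ℝ) (x : ℝ) : ℝ :=
  ∫ z : ℝ, (u x - u (x + z)) / |z| ^ (1 + 2 * s)

section Regularity

variable {s p C : ℝ} {u : ℝ → ℝ}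

theorem norm_fracIntegrand_le (hu : ∀ x y, |u x - u y| ≤ C * min (|x - y| ^ p) 1) (x z : ℝ) :
    ‖(u x - u (x + z)) / |z| ^ (1 + 2 * s)‖ ≤ C * (min (|z| ^ p) 1 / |z| ^ (1 + 2 * s)) := by
  have h := hu x (x + z)
  rw [show x - (x + z) = -z by ring, abs_neg] at h
  rw [norm_div, Real.norm_eq_abs, Real.norm_of_nonneg (by positivity), ← mul_div_assoc]
  gcongr

theorem integrable_fracIntegrand (hs : 0 < s) (hp : 2 * s < p) (hc : Continuous u)
    (hu : ∀ x y, |u x - u y| ≤ C * min (|x - y| ^ p) 1) (x : ℝ) :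
    Integrable (fun z : ℝ => (u x - u (x + z)) / |z| ^ (1 + 2 * s)) := by
  refine Integrable.mono' ((integrable_min_rpow_kernel (by linarith) hp).const_mul C) ?_
    (ae_of_all _ (norm_fracIntegrand_le hu x))
  have := hc.measurable
  apply Measurable.aestronglyMeasurable
  fun_prop

/-- Dominated convergence. Continuity at `0` is what closes the dyadic summation in
`DyadicProfile.holder`. -/
theorem continuous_fracIntegral (hs : 0 < s) (hp : 2 * s < p) (hc : Continuous u)
    (hu : ∀ x y, |u x - u y| ≤ C * min (|x - y| ^ p) 1) : Continuous (fracIntegral s u) := by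
  refine continuous_of_dominated
    (fun x => (integrable_fracIntegrand hs hp hc hu x).aestronglyMeasurable)
    (fun x => ae_of_all _ (norm_fracIntegrand_le hu x))
    ((integrable_min_rpow_kernel (by linarith) hp).const_mul C) (ae_of_all _ fun z => ?_)
  fun_prop

/-- A Hölder exponent above `2s` makes the integrand integrable across the singularity, so the
principal value is an ordinary integral. -/
theorem hasFracLaplacianAt_of_holder (hs : 0 < s) (hp : 2 * s < p) (hc : Continuous u)
    (hu : ∀ x y, |u x - u y| ≤ C * min (|x - y| ^ p) 1) (x : ℝ) :
    HasFracLaplacianAt s u x (fracLaplacianConst s * fracIntegral s u x) := by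
  set g : ℝ → ℝ := fun y => (u x - u y) / |x - y| ^ (1 + 2 * s) with hg
  have hgz : (fun z => g (x + z)) = fun z => (u x - u (x + z)) / |z| ^ (1 + 2 * s) := by
    funext z
    simp only [hg, show x - (x + z) = -z by ring, abs_neg]
  have hint : Integrable g := by
    have h := integrable_fracIntegrand hs hp hc hu x
    rw [← hgz] at h
    simpa using h.comp_sub_right x
  have hval : fracIntegral s u x = ∫ y, g y := by
    rw [fracIntegral, ← hgz, integral_add_left_eq_self]
  refine ⟨fun δ _ => hint.integrableOn, ?_⟩
  rw [hval]
  refine Tendsto.const_mul _ ?_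
  have hms : ∀ δ : ℝ, MeasurableSet {y : ℝ | δ < |x - y|} := fun δ =>
    measurableSet_lt measurable_const (by fun_prop)
  have hind : ∀ δ : ℝ, ∫ y in {y : ℝ | δ < |x - y|}, (u x - u y) / |x - y| ^ (1 + 2 * s) =
      ∫ y, {y : ℝ | δ < |x - y|}.indicator g y := fun δ => (integral_indicator (hms δ)).symm
  simp_rw [hind]
  refine tendsto_integral_filter_of_dominated_convergence (fun y => ‖g y‖)
    (Eventually.of_forall fun δ => (hint.indicator (hms δ)).aestronglyMeasurable)
    (Eventually.of_forall fun δ => ae_of_all _ fun y => norm_indicator_le_norm_self _ _)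
    hint.norm (ae_of_all _ fun y => ?_)
  rcases eq_or_ne y x with rfl | hne
  · have : g y = 0 := by simp [hg]
    refine tendsto_const_nhds.congr fun δ => ?_
    rw [this]
    exact (indicator_apply_eq_zero.2 fun _ => this).symm
  · refine tendsto_const_nhds.congr' ?_
    have hpos : 0 < |x - y| := abs_pos.2 (sub_ne_zero.2 hne.symm)
    filter_upwards [mem_nhdsWithin_of_mem_nhds (Iio_mem_nhds hpos)] with δ hδ
    have hy : y ∈ {y : ℝ | δ < |x - y|} := hδ
    exact (indicator_of_mem hy g).symm

end Regularity

/-! ### Symmetries and scaling -/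

section Symmetry

variable {s : ℝ} {u : ℝ → ℝ}

theorem fracIntegral_add_const (s : ℝ) (u : ℝ → ℝ) (c x : ℝ) :
    fracIntegral s (fun w => u w - c) x = fracIntegral s u x := by
  simp [fracIntegral]

theorem fracIntegral_sub_of_odd {c : ℝ} (h : ∀ x, u (c - x) = -u x) (x : ℝ) :
    fracIntegral s u (c - x) = -fracIntegral s u x := by
  rw [fracIntegral, ← integral_neg_eq_self, fracIntegral, ← integral_neg]
  congr 1
  funext z
  rw [show c - x + -z = c - (x + z) by ring, h, h, abs_neg]
  ring

theorem fracIntegral_neg_of_even (h : ∀ x, u (-x) = u x) (x : ℝ) :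
    fracIntegral s u (-x) = fracIntegral s u x := by
  rw [fracIntegral, ← integral_neg_eq_self, fracIntegral]
  congr 1
  funext z
  rw [show -x + -z = -(x + z) by ring, h, h, abs_neg]

theorem fracIntegral_periodic {T : ℝ} (h : Function.Periodic u T) :
    Function.Periodic (fracIntegral s u) T := by
  intro x
  simp only [fracIntegral]
  congr 1
  funext z
  rw [show x + T + z = x + z + T by ring, h, h]

theorem fracIntegral_comp_mul_left (s : ℝ) (u : ℝ → ℝ) {a : ℝ} (ha : 0 < a) (y : ℝ) :
    fracIntegral s (fun w => u (a * w)) y = a ^ (2 * s) * fracIntegral s u (a * y) := by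
  simp only [fracIntegral]
  have h := Measure.integral_comp_mul_left
    (fun z => (u (a * y) - u (a * y + z)) / |z| ^ (1 + 2 * s)) a
  have h2 : ∀ z : ℝ, (u (a * y) - u (a * (y + z))) / |z| ^ (1 + 2 * s) =
      a ^ (1 + 2 * s) *
        ((u (a * y) - u (a * y + a * z)) / |a * z| ^ (1 + 2 * s)) := by
    intro z
    have := (Real.rpow_pos_of_pos ha (1 + 2 * s)).ne'
    rw [abs_mul, abs_of_pos ha, Real.mul_rpow ha.le (abs_nonneg z), mul_add, ← mul_div_assoc,
      mul_div_mul_left _ _ this]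
  simp_rw [h2]
  rw [integral_const_mul, h, abs_of_pos (inv_pos.2 ha), smul_eq_mul, ← mul_assoc,
    Real.rpow_add ha, Real.rpow_one]
  field_simp

end Symmetry

/-! ### Splitting the kernel into a singular and a bounded part -/

theorem abs_rpow_neg_sub_rpow_neg_le {q τ a b : ℝ} (hq : 0 ≤ q) (hτ : 0 < τ) (ha : τ ≤ a)
    (hb : τ ≤ b) : |a ^ (-q) - b ^ (-q)| ≤ q * τ ^ (-q - 1) * |a - b| := by
  have h := (convex_Ici τ).norm_image_sub_le_of_norm_hasDerivWithin_le
    (f := fun t : ℝ => t ^ (-q)) (f' := fun t => -q * t ^ (-q - 1)) (C := q * τ ^ (-q - 1))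
    (fun t ht => (Real.hasDerivAt_rpow_const
      (Or.inl (lt_of_lt_of_le hτ ht).ne')).hasDerivWithinAt)
    (fun t ht => ?_) hb ha
  · simpa [Real.norm_eq_abs] using h
  · have ht0 : 0 < t := lt_of_lt_of_le hτ ht
    rw [norm_mul, norm_neg, Real.norm_of_nonneg hq, Real.norm_of_nonneg (by positivity)]
    exact mul_le_mul_of_nonneg_left
      (Real.rpow_le_rpow_of_nonpos hτ ht (by linarith)) hq

/-- The kernel `|z|^{-q}`, levelled off near the origin. -/
noncomputable def cutKernel (q z : ℝ) : ℝ := max |z| (1 / 4) ^ (-q)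

theorem cutKernel_nonneg (q z : ℝ) : 0 ≤ cutKernel q z := by
  unfold cutKernel
  positivity

theorem continuous_cutKernel (q : ℝ) : Continuous (cutKernel q) := by
  unfold cutKernel
  exact Continuous.rpow_const (by fun_prop) fun z => Or.inl (by positivity)

theorem integrable_cutKernel {q : ℝ} (hq : 1 < q) : Integrable (cutKernel q) := by
  have h := (integrable_one_add_norm (E := ℝ) (μ := volume) (r := q) (by simpa using hq)).const_mul
    ((1 / 5 : ℝ) ^ (-q))
  refine h.mono' (continuous_cutKernel q).aestronglyMeasurable (ae_of_all _ fun z => ?_)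
  rw [Real.norm_of_nonneg (cutKernel_nonneg q z), cutKernel, Real.norm_eq_abs,
    ← Real.mul_rpow (by norm_num) (by positivity)]
  refine Real.rpow_le_rpow_of_nonpos (by positivity) ?_ (by linarith)
  have h1 := le_max_left |z| (1 / 4)
  have h2 := le_max_right |z| (1 / 4)
  linarith

theorem cutKernel_eq {q z : ℝ} (hz : 1 / 4 ≤ |z|) : cutKernel q z = 1 / |z| ^ q := by
  rw [cutKernel, max_eq_left hz, Real.rpow_neg (abs_nonneg z), one_div]

theorem cutKernel_le {q z : ℝ} (hq : 0 ≤ q) (hz : z ≠ 0) : cutKernel q z ≤ 1 / |z| ^ q := by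
  have : 0 < |z| := abs_pos.2 hz
  rw [cutKernel, one_div (|z| ^ q), ← Real.rpow_neg (abs_nonneg z)]
  exact Real.rpow_le_rpow_of_nonpos this (le_max_left _ _) (by linarith)

/-- The mean value theorem gains one power of decay over the kernel itself, which leaves room for
`U` to grow in `norm_far_le`. -/
theorem abs_cutKernel_sub_le {q y w : ℝ} (hq : 0 ≤ q) (hy1 : 1 ≤ y) (hy2 : y ≤ 2) :
    |cutKernel q (w - 1) - cutKernel q (w - y)| ≤
      q * (1 / 9 : ℝ) ^ (-q - 1) * (1 + |w - 1|) ^ (-q - 1) * (y - 1) := by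
  have htri : |w - 1| ≤ |w - y| + (y - 1) := by
    have := abs_sub_le w y 1
    rwa [abs_of_nonneg (sub_nonneg.2 hy1)] at this
  have h1 := le_max_left |w - 1| (1 / 4)
  have h2 := le_max_right |w - 1| (1 / 4)
  have h3 := le_max_left |w - y| (1 / 4)
  have h4 := le_max_right |w - y| (1 / 4)
  -- Since `|w - y| ≥ |w - 1| - 1`, both truncated distances exceed a multiple of `1 + |w - 1|`; the
  -- factor `1/9` is attained at `|w - 1| = 5/4`.
  have h := abs_rpow_neg_sub_rpow_neg_le hq (τ := 1 / 9 * (1 + |w - 1|)) (by positivity)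
    (a := max |w - 1| (1 / 4)) (b := max |w - y| (1 / 4)) (by linarith) (by linarith)
  rw [Real.mul_rpow (by norm_num) (by positivity), ← mul_assoc] at h
  refine h.trans (mul_le_mul_of_nonneg_left ?_ (by positivity))
  refine (abs_max_sub_max_le_abs _ _ _).trans ((abs_abs_sub_abs_le _ _).trans ?_)
  rw [show w - 1 - (w - y) = y - 1 by ring, abs_of_nonneg (sub_nonneg.2 hy1)]

/-- The substitution `z ↦ r z` produces the exponent `1 - 2s` of the unit-scale estimate. -/
theorem integral_min_kernel_scale (s : ℝ) {r : ℝ} (hr : 0 < r) :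
    ∫ z : ℝ, min r |z| / |z| ^ (1 + 2 * s) =
      r ^ (1 - 2 * s) * ∫ z : ℝ, min (|z| ^ (1 : ℝ)) 1 / |z| ^ (1 + 2 * s) := by
  have h := Measure.integral_comp_mul_left
    (fun z : ℝ => min r |z| / |z| ^ (1 + 2 * s)) r
  have h2 : ∀ z : ℝ, min r |r * z| / |r * z| ^ (1 + 2 * s) =
      r ^ (-(2 * s)) * (min (|z| ^ (1 : ℝ)) 1 / |z| ^ (1 + 2 * s)) := by
    intro z
    have h3 : min r (r * |z|) = r * min (|z| ^ (1 : ℝ)) 1 := by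
      rw [Real.rpow_one, mul_min_of_nonneg _ _ hr.le, mul_one, min_comm]
    rw [abs_mul, abs_of_pos hr, h3, Real.mul_rpow hr.le (abs_nonneg z), Real.rpow_add hr,
      Real.rpow_neg hr.le, Real.rpow_one]
    have := (Real.rpow_pos_of_pos hr (2 * s)).ne'
    generalize min (|z| ^ (1 : ℝ)) 1 = t
    simp only [Real.rpow_one]
    field_simp
  simp_rw [h2] at h
  rw [integral_const_mul, abs_of_pos (inv_pos.2 hr), smul_eq_mul] at h
  rw [Real.rpow_sub hr, Real.rpow_one]
  rw [Real.rpow_neg hr.le] at h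
  rw [eq_comm, inv_mul_eq_iff_eq_mul₀ hr.ne'] at h
  rw [h]
  ring

theorem integrable_min_kernel {s r : ℝ} (hs : 0 < s) (hs1 : 2 * s < 1) (hr : 0 ≤ r) (hr1 : r ≤ 1) :
    Integrable (fun z : ℝ => min r |z| / |z| ^ (1 + 2 * s)) := by
  refine (integrable_min_rpow_kernel (p := 1) (q := 2 * s) (by linarith) hs1).mono' ?_
    (ae_of_all _ fun z => ?_)
  · apply Measurable.aestronglyMeasurable
    fun_prop
  · rw [Real.norm_of_nonneg (by positivity), Real.rpow_one, min_comm]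
    gcongr

/-! ### The Hölder estimate at unit scale -/

section UnitScale

variable {s p A C y : ℝ} {U : ℝ → ℝ}

/-- The double difference is at most `2A(y - 1)` when paired across `1, y`, and at most `2A|z|` when
paired across the shift. The kernel factor vanishes for `|z| ≥ 1/4`, so only points of the Lipschitz
window matter. -/
theorem norm_near_le (hs : 0 < s) (hy1 : 1 ≤ y) (hA : 0 ≤ A)
    (hlip : ∀ w ∈ Icc (3 / 4) (y + 1 / 4), ∀ w' ∈ Icc (3 / 4) (y + 1 / 4),
      |U w - U w'| ≤ A * |w - w'|) (z : ℝ) :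
    ‖((U 1 - U (1 + z)) - (U y - U (y + z))) *
        (1 / |z| ^ (1 + 2 * s) - cutKernel (1 + 2 * s) z)‖ ≤
      2 * A * (min (y - 1) |z| / |z| ^ (1 + 2 * s)) := by
  rcases eq_or_ne z 0 with rfl | hz
  · simp
    positivity
  rcases le_total (1 / 4) |z| with hz4 | hz4
  · rw [cutKernel_eq hz4, sub_self, mul_zero, norm_zero]
    have : 0 ≤ y - 1 := by linarith
    positivity
  have hzz := abs_le.1 hz4
  have hk := cutKernel_le (q := 1 + 2 * s) (by linarith) hz
  have hk0 := cutKernel_nonneg (1 + 2 * s) z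
  have e1 := hlip 1 ⟨by linarith, by linarith⟩ y ⟨by linarith, by linarith⟩
  have e2 := hlip (1 + z) ⟨by linarith, by linarith⟩ (y + z) ⟨by linarith, by linarith⟩
  have e3 := hlip 1 ⟨by linarith, by linarith⟩ (1 + z) ⟨by linarith, by linarith⟩
  have e4 := hlip y ⟨by linarith, by linarith⟩ (y + z) ⟨by linarith, by linarith⟩
  rw [show (1 : ℝ) - y = -(y - 1) by ring, abs_neg, abs_of_nonneg (by linarith : 0 ≤ y - 1)] at e1
  rw [show 1 + z - (y + z) = -(y - 1) by ring, abs_neg,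
    abs_of_nonneg (by linarith : 0 ≤ y - 1)] at e2
  rw [show 1 - (1 + z) = -z by ring, abs_neg] at e3
  rw [show y - (y + z) = -z by ring, abs_neg] at e4
  have b1 : |(U 1 - U (1 + z)) - (U y - U (y + z))| ≤ 2 * A * (y - 1) := by
    rw [show (U 1 - U (1 + z)) - (U y - U (y + z)) = (U 1 - U y) - (U (1 + z) - U (y + z)) by ring]
    exact (abs_sub _ _).trans (by linarith)
  have b2 : |(U 1 - U (1 + z)) - (U y - U (y + z))| ≤ 2 * A * |z| :=
    (abs_sub _ _).trans (by linarith)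
  have b3 : |(U 1 - U (1 + z)) - (U y - U (y + z))| ≤ 2 * A * min (y - 1) |z| := by
    rcases min_choice (y - 1) |z| with h | h <;> rw [h] <;> assumption
  rw [norm_mul, Real.norm_eq_abs, Real.norm_of_nonneg (sub_nonneg.2 hk)]
  refine (mul_le_mul b3 (sub_le_self _ hk0) (sub_nonneg.2 hk) ((abs_nonneg _).trans b3)).trans
    (le_of_eq ?_)
  ring

/-- Growth of order `1 + s` against kernel decay of order `2 + 2s` leaves the integrable power `-(1
+ s)`. -/
theorem norm_far_le (hs : 0 < s) (hy1 : 1 ≤ y) (hy2 : y ≤ 2) (hA : 0 ≤ A)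
    (hgrow : ∀ w, |U w| ≤ A * (1 + |w - 1|) ^ (1 + s)) (w : ℝ) :
    ‖U w * (cutKernel (1 + 2 * s) (w - 1) - cutKernel (1 + 2 * s) (w - y))‖ ≤
      A * ((1 + 2 * s) * (1 / 9 : ℝ) ^ (-(1 + 2 * s) - 1)) * (y - 1) *
        (1 + ‖w - 1‖) ^ (-(1 + s)) := by
  have h1 := abs_cutKernel_sub_le (q := 1 + 2 * s) (w := w) (by linarith) hy1 hy2
  rw [norm_mul, Real.norm_eq_abs, Real.norm_eq_abs, Real.norm_eq_abs]
  refine (mul_le_mul (hgrow w) h1 (abs_nonneg _) (by positivity)).trans (le_of_eq ?_)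
  have h2 : (1 + |w - 1|) ^ (-(1 + s)) =
      (1 + |w - 1|) ^ (1 + s) * (1 + |w - 1|) ^ (-(1 + 2 * s) - 1) := by
    rw [← Real.rpow_add (by positivity)]
    congr 1
    ring
  rw [h2]
  generalize (1 + |w - 1|) ^ (1 + s) = t
  ring

/-- A function of subcritical growth that is Lipschitz near `[1, y]` has a fractional Laplacian
that is Hölder continuous of order `1 - 2 * s` between `1` and `y`. -/
theorem abs_fracIntegral_sub_le_unit (hs : 0 < s) (hs1 : 2 * s < 1) (hp : 2 * s < p)
    (hc : Continuous U) (hU : ∀ x y, |U x - U y| ≤ C * min (|x - y| ^ p) 1)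
    (hy1 : 1 < y) (hy2 : y ≤ 2) (hA : 0 ≤ A)
    (hgrow : ∀ w, |U w| ≤ A * (1 + |w - 1|) ^ (1 + s))
    (hlip : ∀ w ∈ Icc (3 / 4) (y + 1 / 4), ∀ w' ∈ Icc (3 / 4) (y + 1 / 4),
      |U w - U w'| ≤ A * |w - w'|) :
    |fracIntegral s U 1 - fracIntegral s U y| ≤
      (2 * (∫ z : ℝ, min (|z| ^ (1 : ℝ)) 1 / |z| ^ (1 + 2 * s)) +
        (∫ z, cutKernel (1 + 2 * s) z) +
        (1 + 2 * s) * (1 / 9 : ℝ) ^ (-(1 + 2 * s) - 1) * ∫ z : ℝ, (1 + ‖z‖) ^ (-(1 + s))) *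
      A * (y - 1) ^ (1 - 2 * s) := by
  set k := cutKernel (1 + 2 * s) with hk
  have hr : 0 < y - 1 := by linarith
  have hkint : Integrable k := integrable_cutKernel (by linarith)
  have hbdd : ∀ w, ‖U w‖ ≤ |U 0| + |C| := by
    intro w
    have h1 := (hU w 0).trans ((le_abs_self _).trans (abs_mul _ _).le)
    have h2 : |min (|w - 0| ^ p) 1| ≤ 1 := by
      rw [abs_of_nonneg (by positivity)]
      exact min_le_right _ _
    have h3 : |C| * |min (|w - 0| ^ p) 1| ≤ |C| := mul_le_of_le_one_right (abs_nonneg _) h2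
    have h4 := abs_sub_abs_le_abs_sub (U w) (U 0)
    rw [Real.norm_eq_abs]
    linarith
  have hUk : ∀ a b : ℝ, Integrable fun z => U (a + z) * k (b + z) := fun a b =>
    (hkint.comp_add_left b).bdd_mul (by fun_prop) (ae_of_all _ fun z => hbdd _)
  have hg1 := integrable_fracIntegrand hs hp hc hU 1
  have hgy := integrable_fracIntegrand hs hp hc hU y
  have hDk : Integrable fun z => ((U 1 - U (1 + z)) - (U y - U (y + z))) * k z := by
    have := ((hkint.const_mul (U 1 - U y)).sub (hUk 1 0)).add (hUk y 0)
    refine this.congr (ae_of_all _ fun z => ?_)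
    simp only [Pi.add_apply, Pi.sub_apply, zero_add]
    ring
  have hnear : Integrable fun z => ((U 1 - U (1 + z)) - (U y - U (y + z))) *
      (1 / |z| ^ (1 + 2 * s) - k z) := by
    refine ((hg1.sub hgy).sub hDk).congr (ae_of_all _ fun z => ?_)
    simp only [Pi.sub_apply]
    ring
  -- For the bounded kernel, translation moves the difference between `1` and `y` from `U` onto `k`,
  -- so far away only the growth of `U` is used.
  have hsplit : fracIntegral s U 1 - fracIntegral s U y =
      (∫ z, ((U 1 - U (1 + z)) - (U y - U (y + z))) * (1 / |z| ^ (1 + 2 * s) - k z)) +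
      ((U 1 - U y) * (∫ z, k z) - ∫ w, U w * (k (w - 1) - k (w - y))) := by
    have e1 : fracIntegral s U 1 - fracIntegral s U y =
        (∫ z, ((U 1 - U (1 + z)) - (U y - U (y + z))) * (1 / |z| ^ (1 + 2 * s) - k z)) +
        ∫ z, ((U 1 - U (1 + z)) - (U y - U (y + z))) * k z := by
      rw [← integral_add hnear hDk, fracIntegral, fracIntegral, ← integral_sub hg1 hgy]
      congr 1
      funext z
      ring
    have e2 : ∀ a : ℝ, ∫ z, U (a + z) * k (0 + z) = ∫ w, U w * k (w - a) := by
      intro a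
      rw [← integral_add_left_eq_self (fun w => U w * k (w - a)) a]
      simp
    have e3 : ∫ z, ((U 1 - U (1 + z)) - (U y - U (y + z))) * k z =
        (U 1 - U y) * (∫ z, k z) - ((∫ z, U (1 + z) * k (0 + z)) - ∫ z, U (y + z) * k (0 + z)) := by
      rw [← integral_const_mul, ← integral_sub (hUk 1 0) (hUk y 0)]
      refine Eq.trans ?_ (integral_sub (hkint.const_mul (U 1 - U y)) ((hUk 1 0).sub (hUk y 0)))
      congr 1
      funext z
      simp only [zero_add]
      ring
    have e4 : (∫ w, U w * k (w - 1)) - (∫ w, U w * k (w - y)) =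
        ∫ w, U w * (k (w - 1) - k (w - y)) := by
      rw [← integral_sub]
      · congr 1
        funext w
        ring
      · simpa [neg_add_eq_sub] using hUk 0 (-1)
      · simpa [neg_add_eq_sub] using hUk 0 (-y)
    rw [e1, e3, e2, e2, e4]
  have b1 : |∫ z, ((U 1 - U (1 + z)) - (U y - U (y + z))) * (1 / |z| ^ (1 + 2 * s) - k z)| ≤
      2 * A * ((y - 1) ^ (1 - 2 * s) *
        ∫ z : ℝ, min (|z| ^ (1 : ℝ)) 1 / |z| ^ (1 + 2 * s)) := by
    rw [← integral_min_kernel_scale s hr, ← integral_const_mul, ← Real.norm_eq_abs]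
    exact norm_integral_le_of_norm_le
      ((integrable_min_kernel hs hs1 hr.le (by linarith)).const_mul _)
      (ae_of_all _ (norm_near_le hs hy1.le hA hlip))
  have hrr : y - 1 ≤ (y - 1) ^ (1 - 2 * s) := by
    simpa using Real.rpow_le_rpow_of_exponent_ge hr (by linarith) (by linarith : 1 - 2 * s ≤ 1)
  have hk0 : 0 ≤ ∫ z, k z := integral_nonneg (cutKernel_nonneg _)
  have b2 : |(U 1 - U y) * ∫ z, k z| ≤ A * (y - 1) ^ (1 - 2 * s) * ∫ z, k z := by
    rw [abs_mul, abs_of_nonneg hk0]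
    refine mul_le_mul_of_nonneg_right ?_ hk0
    have := hlip 1 ⟨by norm_num, by linarith⟩ y ⟨by linarith, by linarith⟩
    rw [show (1 : ℝ) - y = -(y - 1) by ring, abs_neg, abs_of_pos hr] at this
    exact this.trans (by gcongr)
  have hJ : Integrable fun z : ℝ => (1 + ‖z‖) ^ (-(1 + s)) :=
    integrable_one_add_norm (by simpa using hs)
  have hJ0 : 0 ≤ ∫ z : ℝ, (1 + ‖z‖) ^ (-(1 + s)) := integral_nonneg fun z => by positivity
  have b3 : |∫ w, U w * (k (w - 1) - k (w - y))| ≤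
      A * ((1 + 2 * s) * (1 / 9 : ℝ) ^ (-(1 + 2 * s) - 1)) * (y - 1) ^ (1 - 2 * s) *
        ∫ z : ℝ, (1 + ‖z‖) ^ (-(1 + s)) := by
    refine le_trans (b := A * ((1 + 2 * s) * (1 / 9 : ℝ) ^ (-(1 + 2 * s) - 1)) * (y - 1) *
        ∫ z : ℝ, (1 + ‖z‖) ^ (-(1 + s))) ?_ (by gcongr)
    rw [← integral_sub_right_eq_self (fun z : ℝ => (1 + ‖z‖) ^ (-(1 + s))) 1,
      ← integral_const_mul, ← Real.norm_eq_abs]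
    exact norm_integral_le_of_norm_le ((hJ.comp_sub_right 1).const_mul _)
      (ae_of_all _ (norm_far_le hs hy1.le hy2 hA hgrow))
  rw [hsplit]
  refine (abs_add_le _ _).trans ((add_le_add b1 ((abs_sub _ _).trans (add_le_add b2 b3))).trans
    (le_of_eq ?_))
  ring

end UnitScale

/-! ### From dyadic scales to Hölder control up to the extremum -/

/-- `u` behaves at the origin like an increasing function of size `m`, uniformly on dyadic scales
in `(0, a]`. -/
structure DyadicProfile (s a A c : ℝ) (m u : ℝ → ℝ) : Prop where
  pos : ∀ x, 0 < x → x ≤ a → 0 < m x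
  mono : MonotoneOn u (Icc 0 a)
  growth : ∀ x, 0 < x → x ≤ a → ∀ w, |u w - u 0| ≤ A * m x * (1 + |w| / x) ^ (1 + s)
  lipschitz : ∀ x y, 0 < x → x ≤ y → y ≤ a → y ≤ 2 * x →
    ∀ w ∈ Icc (3 / 4 * x) (y + x / 4), ∀ w' ∈ Icc (3 / 4 * x) (y + x / 4),
      |u w - u w'| ≤ A * m x / x * |w - w'|
  lower : ∀ x y, 0 < x → x ≤ y → y ≤ a → y ≤ 2 * x → c * m x * ((y - x) / x) ≤ u y - u x

namespace DyadicProfile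

variable {s β p C a A c : ℝ} {m u : ℝ → ℝ}

/-- Dilation by `x` reduces to the unit-scale estimate with constant `4 A m(x)`; `hm` and `β ≤ 1 -
2s` turn its right side into a power `β` of the lower bound for `u y - u x`. -/
theorem holder_local (h : DyadicProfile s a A c m u) (hs : 0 < s) (hs1 : 2 * s < 1)
    (hp : 2 * s < p) (hβ : 0 < β) (hβs : β ≤ 1 - 2 * s) (hA : 0 < A) (hc0 : 0 < c)
    (hc : Continuous u) (hu : ∀ x y, |u x - u y| ≤ C * min (|x - y| ^ p) 1)
    (hm : ∀ x, 0 < x → x ≤ a → m x ^ (1 - β) ≤ x ^ (2 * s)) :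
    ∃ K, 0 ≤ K ∧ ∀ x y, 0 < x → x < y → y ≤ a → y ≤ 2 * x →
      |fracIntegral s u x - fracIntegral s u y| ≤ K * (u y - u x) ^ β := by
  set K₀ := 2 * (∫ z : ℝ, min (|z| ^ (1 : ℝ)) 1 / |z| ^ (1 + 2 * s)) +
        (∫ z, cutKernel (1 + 2 * s) z) +
        (1 + 2 * s) * (1 / 9 : ℝ) ^ (-(1 + 2 * s) - 1) * ∫ z : ℝ, (1 + ‖z‖) ^ (-(1 + s)) with hK₀
  have hK₀0 : 0 ≤ K₀ := by
    have h1 : 0 ≤ ∫ z : ℝ, min (|z| ^ (1 : ℝ)) 1 / |z| ^ (1 + 2 * s) :=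
      integral_nonneg fun z => by positivity
    have h2 : 0 ≤ ∫ z, cutKernel (1 + 2 * s) z := integral_nonneg (cutKernel_nonneg _)
    have h3 : 0 ≤ ∫ z : ℝ, (1 + ‖z‖) ^ (-(1 + s)) := integral_nonneg fun z => by positivity
    positivity
  refine ⟨K₀ * (4 * A) * (c⁻¹) ^ β, by positivity, fun x y hx hxy hya hy2 => ?_⟩
  have hxa : x ≤ a := hxy.le.trans hya
  have hmx := h.pos x hx hxa
  have hC : 0 ≤ C := by
    have := (abs_nonneg _).trans (hu 0 1)
    simpa using this
  have hr : 0 < (y - x) / x := div_pos (by linarith) hx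
  have hyx : y / x = 1 + (y - x) / x := by
    field_simp
    ring
  have hr1 : (y - x) / x ≤ 1 := by
    rw [div_le_one hx]
    linarith
  -- The constant `C * (x ^ p + 1)` depends badly on `x`, but it only secures integrability and does
  -- not enter the estimate.
  have hunit := abs_fracIntegral_sub_le_unit (U := fun w => u (x * w) - u 0) (y := y / x)
    (A := 4 * A * m x) (C := C * (x ^ p + 1)) hs hs1 hp (by fun_prop) (fun v w => ?_)
    (by linarith) (by linarith) (by positivity) (fun w => ?_) (fun w hw w' hw' => ?_)
  · rw [fracIntegral_add_const, fracIntegral_add_const, fracIntegral_comp_mul_left s u hx,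
      fracIntegral_comp_mul_left s u hx, mul_one, mul_div_cancel₀ _ hx.ne', ← mul_sub, abs_mul,
      abs_of_nonneg (by positivity : 0 ≤ x ^ (2 * s)), ← hK₀] at hunit
    have e1 : (y / x - 1) ^ (1 - 2 * s) ≤ ((y - x) / x) ^ β := by
      rw [hyx, add_sub_cancel_left]
      exact Real.rpow_le_rpow_of_exponent_ge hr hr1 hβs
    have e2 : m x ≤ m x ^ β * x ^ (2 * s) := by
      calc m x = m x ^ β * m x ^ (1 - β) := by
            rw [← Real.rpow_add hmx, add_sub_cancel, Real.rpow_one]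
        _ ≤ _ := by
            gcongr
            exact hm x hx hxa
    have e3 : (m x * ((y - x) / x)) ^ β ≤ (c⁻¹) ^ β * (u y - u x) ^ β := by
      have hl := h.lower x y hx hxy.le hya hy2
      have hl0 : 0 ≤ u y - u x := le_trans (by positivity) hl
      rw [← Real.mul_rpow (by positivity) hl0]
      refine Real.rpow_le_rpow (by positivity) ?_ hβ.le
      rw [le_inv_mul_iff₀ hc0]
      linarith
    have hx2 : 0 < x ^ (2 * s) := Real.rpow_pos_of_pos hx _
    refine le_of_mul_le_mul_left (hunit.trans ?_) hx2
    have hyx0 : 0 ≤ y / x - 1 := by linarith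
    calc K₀ * (4 * A * m x) * (y / x - 1) ^ (1 - 2 * s)
        ≤ K₀ * (4 * A * (m x ^ β * x ^ (2 * s))) * ((y - x) / x) ^ β := by gcongr
      _ = x ^ (2 * s) * (K₀ * (4 * A) * (m x * ((y - x) / x)) ^ β) := by
          rw [Real.mul_rpow hmx.le hr.le]
          ring
      _ ≤ x ^ (2 * s) * (K₀ * (4 * A) * ((c⁻¹) ^ β * (u y - u x) ^ β)) := by gcongr
      _ = _ := by ring
  · have h1 := hu (x * v) (x * w)
    rw [← mul_sub, abs_mul, abs_of_pos hx, Real.mul_rpow hx.le (abs_nonneg _)] at h1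
    rw [sub_sub_sub_cancel_right, mul_assoc]
    refine h1.trans (mul_le_mul_of_nonneg_left ?_ hC)
    have hxp : 0 < x ^ p := Real.rpow_pos_of_pos hx p
    have ht : 0 ≤ |v - w| ^ p := by positivity
    rcases le_total (|v - w| ^ p) 1 with hcase | hcase
    · rw [min_eq_left hcase]
      refine (min_le_left _ _).trans ?_
      nlinarith
    · rw [min_eq_right hcase]
      refine (min_le_right _ _).trans ?_
      linarith
  · have h1 := h.growth x hx hxa (x * w)
    rw [abs_mul, abs_of_pos hx, mul_div_cancel_left₀ _ hx.ne'] at h1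
    refine h1.trans ?_
    have h2 : 1 + |w| ≤ 2 * (1 + |w - 1|) := by
      have := abs_sub_abs_le_abs_sub w 1
      rw [abs_one] at this
      have := abs_nonneg (w - 1)
      linarith
    have h3 : (1 + |w|) ^ (1 + s) ≤ 2 ^ (1 + s) * (1 + |w - 1|) ^ (1 + s) := by
      rw [← Real.mul_rpow (by norm_num) (by positivity)]
      exact Real.rpow_le_rpow (by positivity) h2 (by linarith)
    have h4 : (2 : ℝ) ^ (1 + s) ≤ 4 := by
      calc (2 : ℝ) ^ (1 + s) ≤ 2 ^ (2 : ℝ) :=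
            Real.rpow_le_rpow_of_exponent_le (by norm_num) (by linarith)
        _ = 4 := by norm_num
    calc A * m x * (1 + |w|) ^ (1 + s) ≤ A * m x * (4 * (1 + |w - 1|) ^ (1 + s)) := by
          refine mul_le_mul_of_nonneg_left (h3.trans ?_) (by positivity)
          gcongr
      _ = _ := by ring
  · have hmem : ∀ v ∈ Icc (3 / 4 : ℝ) (y / x + 1 / 4), x * v ∈ Icc (3 / 4 * x) (y + x / 4) := by
      intro v hv
      refine ⟨by nlinarith [hv.1], ?_⟩
      have := mul_le_mul_of_nonneg_left hv.2 hx.le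
      rw [mul_add, mul_div_cancel₀ _ hx.ne'] at this
      linarith
    have h1 := h.lipschitz x y hx hxy.le hya hy2 _ (hmem w hw) _ (hmem w' hw')
    rw [sub_sub_sub_cancel_right]
    refine h1.trans ?_
    rw [← mul_sub, abs_mul, abs_of_pos hx]
    have : A * m x / x * (x * |w - w'|) = A * m x * |w - w'| := by
      field_simp
    rw [this]
    gcongr
    linarith

/-- The increment over `[x/2, x]` is at least `c m(x/2)`, while `u(x/2) - u(0)` is at most `4 A
m(x/2)`, so halving loses a definite fraction. -/
theorem half_le (h : DyadicProfile s a A c m u) (hs1 : s ≤ 1) (hA : 0 < A)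
    (hc0 : 0 < c) {x : ℝ} (hx : 0 < x) (hxa : x ≤ a) :
    u (x / 2) - u 0 ≤ (1 + c / (4 * A))⁻¹ * (u x - u 0) := by
  have h1 := h.lower (x / 2) x (by linarith) (by linarith) hxa (by linarith)
  have h2 := (le_abs_self _).trans (h.growth (x / 2) (by linarith) (by linarith) (x / 2))
  have hm := h.pos (x / 2) (by linarith) (by linarith)
  have e1 : (x - x / 2) / (x / 2) = 1 := by
    field_simp
    ring
  have e2 : |x / 2| / (x / 2) = 1 := by
    rw [abs_of_pos (by linarith), div_self (by linarith)]
  rw [e1, mul_one] at h1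
  rw [e2] at h2
  have h4 : (1 + 1 : ℝ) ^ (1 + s) ≤ 4 := by
    calc (1 + 1 : ℝ) ^ (1 + s) ≤ (1 + 1) ^ (2 : ℝ) :=
          Real.rpow_le_rpow_of_exponent_le (by norm_num) (by linarith)
      _ = 4 := by norm_num
  have h5 : u (x / 2) - u 0 ≤ 4 * A * m (x / 2) := by
    refine h2.trans ?_
    have := mul_le_mul_of_nonneg_left h4 (mul_pos hA hm).le
    linarith
  rw [le_inv_mul_iff₀ (by positivity), add_mul, one_mul]
  have h6 : c / (4 * A) * (u (x / 2) - u 0) ≤ c / (4 * A) * (4 * A * m (x / 2)) := by gcongr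
  have h7 : c / (4 * A) * (4 * A * m (x / 2)) = c * m (x / 2) := by field_simp
  linarith

theorem holder (h : DyadicProfile s a A c m u) (hs : 0 < s) (hs1 : 2 * s < 1)
    (hp : 2 * s < p) (hβ : 0 < β) (hβs : β ≤ 1 - 2 * s) (hA : 0 < A) (hc0 : 0 < c)
    (hc : Continuous u) (hu : ∀ x y, |u x - u y| ≤ C * min (|x - y| ^ p) 1)
    (hm : ∀ x, 0 < x → x ≤ a → m x ^ (1 - β) ≤ x ^ (2 * s)) :
    ∃ K, 0 ≤ K ∧ ∀ x ∈ Icc 0 a, ∀ y ∈ Icc 0 a,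
      |fracIntegral s u x - fracIntegral s u y| ≤ K * |u x - u y| ^ β := by
  obtain ⟨K, hK, hloc⟩ := h.holder_local hs hs1 hp hβ hβs hA hc0 hc hu hm
  set q := (1 + c / (4 * A))⁻¹ with hq
  have hq0 : 0 < q := by positivity
  have hq1 : q < 1 := inv_lt_one_of_one_lt₀ (by have : 0 < c / (4 * A) := by positivity
                                                linarith)
  have hqβ : q ^ β < 1 := Real.rpow_lt_one hq0.le hq1 hβ
  have hqβ0 : 0 < q ^ β := by positivity
  set H := fracIntegral s u with hH
  have hHc : Continuous H := continuous_fracIntegral hs hp hc hu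
  have hv0 : ∀ x, 0 ≤ x → x ≤ a → 0 ≤ u x - u 0 := fun x hx hxa =>
    sub_nonneg.2 (h.mono ⟨le_rfl, hx.trans hxa⟩ ⟨hx, hxa⟩ hx)
  -- The sum of the geometric series, that is, the solution of `K + K₁ q^β = K₁`.
  set K₁ := K / (1 - q ^ β) with hK₁
  have hK₁0 : 0 ≤ K₁ := div_nonneg hK (by linarith)
  have hK₁e : K₁ * (1 - q ^ β) = K := div_mul_cancel₀ _ (by linarith)
  have hstep : ∀ x, 0 < x → x ≤ a → |H x - H 0| - K₁ * (u x - u 0) ^ β ≤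
      |H (x / 2) - H 0| - K₁ * (u (x / 2) - u 0) ^ β := by
    intro x hx hxa
    have h0 := hv0 x hx.le hxa
    have h1 := hv0 (x / 2) (by linarith) (by linarith)
    have h2 := hloc (x / 2) x (by linarith) (by linarith) hxa (by linarith)
    have h3 : (u (x / 2) - u 0) ^ β ≤ q ^ β * (u x - u 0) ^ β := by
      rw [← Real.mul_rpow hq0.le h0]
      exact Real.rpow_le_rpow h1 (h.half_le (by linarith) hA hc0 hx hxa) hβ.le
    have h4 : (u x - u (x / 2)) ^ β ≤ (u x - u 0) ^ β := by
      refine Real.rpow_le_rpow (sub_nonneg.2 ?_) (by linarith) hβ.le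
      exact h.mono ⟨by linarith, by linarith⟩ ⟨hx.le, hxa⟩ (by linarith)
    have h5 := abs_sub_le (H x) (H (x / 2)) (H 0)
    rw [abs_sub_comm (H x) (H (x / 2))] at h5
    have h6 := mul_le_mul_of_nonneg_left h4 hK
    have h7 := mul_le_mul_of_nonneg_left h3 hK₁0
    rw [← hK₁e] at h2 h6
    nlinarith
  have hiter : ∀ n : ℕ, ∀ x, 0 < x → x ≤ a → |H x - H 0| - K₁ * (u x - u 0) ^ β ≤
      |H (x / 2 ^ n) - H 0| - K₁ * (u (x / 2 ^ n) - u 0) ^ β := by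
    intro n
    induction n with
    | zero => intro x _ _; simp
    | succ n ih =>
      intro x hx hxa
      refine (hstep x hx hxa).trans ((ih (x / 2) (by linarith) (by linarith)).trans (le_of_eq ?_))
      rw [div_div, ← pow_succ']
  have hzero : ∀ x, 0 ≤ x → x ≤ a → |H x - H 0| ≤ K₁ * (u x - u 0) ^ β := by
    intro x hx hxa
    rcases hx.eq_or_lt with rfl | hx
    · simp [Real.zero_rpow hβ.ne']
    rw [← sub_nonpos]
    have ht : Tendsto (fun n : ℕ => x / 2 ^ n) atTop (𝓝 0) :=
      tendsto_const_nhds.div_atTop (tendsto_pow_atTop_atTop_of_one_lt (by norm_num))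
    have ht2 : Tendsto (fun n : ℕ => |H (x / 2 ^ n) - H 0|) atTop (𝓝 0) := by
      have := ((hHc.tendsto 0).comp ht).sub_const (H 0)
      simpa using this.abs
    -- The subtracted term is nonnegative, so the iterated quantity is bounded by `|H (x / 2 ^ n) -
    -- H 0|`, which tends to zero.
    refine ge_of_tendsto' ht2 fun n => (hiter n x hx hxa).trans (sub_le_self _ ?_)
    have h2n : (1 : ℝ) ≤ 2 ^ n := one_le_pow₀ (by norm_num)
    have := hv0 (x / 2 ^ n) (by positivity) ((div_le_self hx.le h2n).trans hxa)
    positivity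
  have hq1' : 0 < 1 - q := by linarith
  refine ⟨K + 2 * K₁ * ((1 - q)⁻¹) ^ β, by positivity, ?_⟩
  have key : ∀ x y, 0 ≤ x → x < y → y ≤ a →
      |H x - H y| ≤ (K + 2 * K₁ * ((1 - q)⁻¹) ^ β) * |u x - u y| ^ β := by
    intro x y hx hxy hya
    have hmxy : u x ≤ u y := h.mono ⟨hx, hxy.le.trans hya⟩ ⟨hx.trans hxy.le, hya⟩ hxy.le
    rw [abs_sub_comm (u x), abs_of_nonneg (sub_nonneg.2 hmxy), add_mul]
    have hD : 0 ≤ (u y - u x) ^ β := Real.rpow_nonneg (sub_nonneg.2 hmxy) _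
    rcases le_or_gt y (2 * x) with h2 | h2
    · have := hloc x y (by linarith) hxy hya h2
      have : 0 ≤ 2 * K₁ * ((1 - q)⁻¹) ^ β * (u y - u x) ^ β := by positivity
      linarith
    -- For `y > 2x`, go through `0`: `u x ≤ u (y/2)` makes `u y - u x` at least `(1 - q)(u y - u
    -- 0)`.
    · have e1 := hzero x hx (by linarith)
      have e2 := hzero y (by linarith) hya
      have e3 := abs_sub_le (H x) (H 0) (H y)
      rw [abs_sub_comm (H 0)] at e3
      have hmono : u x ≤ u (y / 2) :=
        h.mono ⟨hx, by linarith⟩ ⟨by linarith, by linarith⟩ (by linarith)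
      have hhalf := h.half_le (by linarith) hA hc0 (by linarith : 0 < y) hya
      rw [← hq] at hhalf
      have e4 : u y - u 0 ≤ (1 - q)⁻¹ * (u y - u x) := by
        rw [le_inv_mul_iff₀ hq1']
        linarith
      have e5 : (u y - u 0) ^ β ≤ ((1 - q)⁻¹) ^ β * (u y - u x) ^ β := by
        rw [← Real.mul_rpow (by positivity) (sub_nonneg.2 hmxy)]
        exact Real.rpow_le_rpow (hv0 y (by linarith) hya) e4 hβ.le
      have e6 : (u x - u 0) ^ β ≤ (u y - u 0) ^ β :=
        Real.rpow_le_rpow (hv0 x hx (by linarith)) (by linarith) hβ.le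
      have e7 := mul_le_mul_of_nonneg_left e5 hK₁0
      have e8 := mul_le_mul_of_nonneg_left e6 hK₁0
      have e9 : 0 ≤ K * (u y - u x) ^ β := by positivity
      linarith
  intro x hx y hy
  rcases lt_trichotomy x y with hxy | rfl | hxy
  · exact key x y hx.1 hxy hy.2
  · simp only [sub_self, abs_zero]
    positivity
  · rw [abs_sub_comm, abs_sub_comm (u x)]
    exact key y x hy.1 hxy hx.2

end DyadicProfile

/-! ### Estimates for the logarithmic power -/

/-- The even profile `|t|^α / (1 - log |t|)`, of Hölder exponent exactly `α` at the origin, and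
continuously differentiable there when `α = 1`. -/
noncomputable def logPower (α t : ℝ) : ℝ := |t| ^ α / (1 - Real.log t)

section LogPower

variable {α s p q t x : ℝ}

theorem logPower_neg (α t : ℝ) : logPower α (-t) = logPower α t := by
  simp [logPower]

theorem logPower_abs (α t : ℝ) : logPower α |t| = logPower α t := by
  simp [logPower]

theorem logPower_zero (hα : 0 < α) : logPower α 0 = 0 := by
  simp [logPower, Real.zero_rpow hα.ne']

theorem logPower_one (α : ℝ) : logPower α 1 = 1 := by
  simp [logPower]

theorem one_le_one_sub_log (ht : 0 ≤ t) (ht1 : t ≤ 1) : 1 ≤ 1 - Real.log t := by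
  have := Real.log_nonpos ht ht1
  linarith

theorem logPower_nonneg (ht : |t| ≤ 1) : 0 ≤ logPower α t := by
  rw [← logPower_abs, logPower, abs_abs]
  have := one_le_one_sub_log (abs_nonneg t) ht
  positivity

theorem logPower_pos (ht : 0 < t) (ht1 : t ≤ 1) : 0 < logPower α t := by
  rw [logPower]
  have := one_le_one_sub_log ht.le ht1
  positivity

theorem logPower_le_rpow (ht : 0 ≤ t) (ht1 : t ≤ 1) : logPower α t ≤ t ^ α := by
  rw [logPower, abs_of_nonneg ht]
  exact div_le_self (by positivity) (one_le_one_sub_log ht ht1)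

/-- `φ(t)/t²` is nonincreasing on `(0, 1]`: one factor `p/q` pays for the power, as `α ≤ 1`, the
other for the logarithm. Doubling, `t² ≤ φ(t)` and the upper increment bound all follow. -/
theorem sq_ratio_mul_logPower_le (hα1 : α ≤ 1) (hp : 0 < p) (hpq : p ≤ q) (hq1 : q ≤ 1) :
    (p / q) ^ 2 * logPower α q ≤ logPower α p := by
  have hq : 0 < q := hp.trans_le hpq
  have hLp := one_le_one_sub_log hp.le (hpq.trans hq1)
  have hLq := one_le_one_sub_log hq.le hq1
  have h1 : p / q ≤ (p / q) ^ α := by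
    simpa using Real.rpow_le_rpow_of_exponent_ge (div_pos hp hq) ((div_le_one hq).2 hpq) hα1
  rw [Real.div_rpow hp.le hq.le] at h1
  have h2 : 1 - Real.log p ≤ q / p * (1 - Real.log q) := by
    have h3 := Real.log_le_sub_one_of_pos (div_pos hq hp)
    rw [Real.log_div hq.ne' hp.ne'] at h3
    have h4 : 1 ≤ q / p := (one_le_div hp).2 hpq
    nlinarith
  have hpa : 0 < p ^ α := Real.rpow_pos_of_pos hp _
  have hqa : 0 < q ^ α := Real.rpow_pos_of_pos hq _
  rw [le_div_iff₀ hqa] at h1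
  simp only [logPower, abs_of_pos hp, abs_of_pos hq]
  rw [← mul_div_assoc, div_le_div_iff₀ (by linarith) (by linarith)]
  calc (p / q) ^ 2 * q ^ α * (1 - Real.log p)
      = (p / q) * (p / q * q ^ α) * (1 - Real.log p) := by ring
    _ ≤ (p / q) * p ^ α * (q / p * (1 - Real.log q)) := by gcongr
    _ = p ^ α * (1 - Real.log q) := by field_simp

theorem sq_le_logPower (hα : 0 < α) (hα1 : α ≤ 1) (ht : |t| ≤ 1) : t ^ 2 ≤ logPower α t := by
  rcases eq_or_ne t 0 with rfl | h0
  · simp [logPower_zero hα]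
  · have := sq_ratio_mul_logPower_le hα1 (abs_pos.2 h0) ht le_rfl
    simpa [logPower_one, logPower_abs] using this

/-- With `θ = p/q`, the previous monotonicity and `1 - θ² ≤ 2(1 - θ)`. -/
theorem logPower_sub_le (hα : 0 < α) (hα1 : α ≤ 1) (hp : 0 ≤ p) (hpq : p ≤ q) (hq1 : q ≤ 1) :
    logPower α q - logPower α p ≤ 2 * logPower α q * ((q - p) / q) := by
  rcases hp.eq_or_lt with rfl | hp
  · rcases hpq.eq_or_lt with rfl | hq
    · simp
    · rw [logPower_zero hα, sub_zero, sub_zero, div_self hq.ne']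
      linarith [logPower_pos (α := α) hq hq1]
  · have hq : 0 < q := hp.trans_le hpq
    have h := sq_ratio_mul_logPower_le hα1 hp hpq hq1
    have h0 := (logPower_pos (α := α) hq hq1).le
    have : (q - p) / q = 1 - p / q := by field_simp
    rw [this]
    nlinarith [mul_nonneg (sq_nonneg (1 - p / q)) h0]

/-- The logarithmic denominator only helps, so it is frozen at `p`; Bernoulli's inequality handles
the power. -/
theorem le_logPower_sub (hα : 0 < α) (hα1 : α ≤ 1) (hp : 0 < p) (hpq : p ≤ q) (hq1 : q ≤ 1) :
    α * logPower α p * ((q - p) / q) ≤ logPower α q - logPower α p := by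
  have hq : 0 < q := hp.trans_le hpq
  have hLp := one_le_one_sub_log hp.le (hpq.trans hq1)
  have hLq := one_le_one_sub_log hq.le hq1
  have hpa : 0 < p ^ α := Real.rpow_pos_of_pos hp _
  have hqa : 0 < q ^ α := Real.rpow_pos_of_pos hq _
  have hpq' : p ^ α ≤ q ^ α := Real.rpow_le_rpow hp.le hpq hα.le
  have h1 : (p / q) ^ α ≤ 1 - α * ((q - p) / q) := by
    have h := rpow_one_add_le_one_add_mul_self (s := p / q - 1)
      (by linarith [div_pos hp hq]) hα.le hα1
    have h2 : p / q - 1 = -((q - p) / q) := by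
      field_simp
      ring
    rw [add_sub_cancel, h2] at h
    linarith
  rw [Real.div_rpow hp.le hq.le, div_le_iff₀ hqa] at h1
  have h3 : q ^ α / (1 - Real.log p) ≤ logPower α q := by
    rw [logPower, abs_of_pos hq]
    have := Real.log_le_log hp hpq
    gcongr
  have h4 : logPower α p = p ^ α / (1 - Real.log p) := by rw [logPower, abs_of_pos hp]
  refine le_trans ?_ (sub_le_sub_right h3 _)
  have h5 : 0 ≤ α * ((q - p) / q) := mul_nonneg hα.le (div_nonneg (by linarith) hq.le)
  have h6 : α * (p ^ α / (1 - Real.log p)) * ((q - p) / q) =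
      α * ((q - p) / q) * p ^ α / (1 - Real.log p) := by ring
  rw [h4, ← sub_div, h6]
  gcongr
  nlinarith

theorem logPower_mono (hα : 0 < α) (hα1 : α ≤ 1) (hp : 0 ≤ p) (hpq : p ≤ q) (hq1 : q ≤ 1) :
    logPower α p ≤ logPower α q := by
  rcases hp.eq_or_lt with rfl | hp
  · rw [logPower_zero hα]
    exact logPower_nonneg (abs_le.2 ⟨by linarith, hq1⟩)
  · have h := le_logPower_sub hα hα1 hp hpq hq1
    have : 0 ≤ α * logPower α p * ((q - p) / q) :=
      mul_nonneg (mul_nonneg hα.le (logPower_pos hp (hpq.trans hq1)).le)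
        (div_nonneg (by linarith) (by linarith))
    linarith

theorem logPower_le_one (hα : 0 < α) (ht : |t| ≤ 1) : logPower α t ≤ 1 := by
  rw [← logPower_abs]
  exact (logPower_le_rpow (abs_nonneg t) ht).trans (Real.rpow_le_one (abs_nonneg t) ht hα.le)

/-- The logarithm costs an arbitrarily small power, here `s`, through `log v ≤ v^s / s`; hence the
factor `1 + 1/s`. -/
theorem logPower_growth (hα : 0 < α) (hα1 : α ≤ 1) (hs : 0 < s) (hx : 0 < x) (hx1 : x ≤ 1)
    (ht : 0 ≤ t) (ht1 : t ≤ 1) :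
    logPower α t ≤ (1 + 1 / s) * logPower α x * (1 + t / x) ^ (1 + s) := by
  have hφ := logPower_pos (α := α) hx hx1
  have htx : 0 ≤ t / x := by positivity
  have hone : 1 ≤ (1 + t / x) ^ (1 + s) := Real.one_le_rpow (by linarith) (by linarith)
  have hs' : 1 ≤ 1 + 1 / s := by
    have : 0 < 1 / s := by positivity
    linarith
  rcases le_total t x with h | h
  · refine (logPower_mono hα hα1 ht h hx1).trans ?_
    calc logPower α x = 1 * logPower α x * 1 := by ring
      _ ≤ _ := by gcongr
  · have ht0 : 0 < t := hx.trans_le h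
    have hLx := one_le_one_sub_log hx.le hx1
    have hLt := one_le_one_sub_log ht ht1
    have hv : 1 ≤ t / x := (one_le_div hx).2 h
    have hvs : 1 ≤ (t / x) ^ s := Real.one_le_rpow hv hs.le
    have h1 : 1 - Real.log x ≤ (1 + 1 / s) * (t / x) ^ s * (1 - Real.log t) := by
      have h2 := Real.log_le_rpow_div (by linarith : 0 ≤ t / x) hs
      have h2' : 0 ≤ (t / x) ^ s / s := by positivity
      have h3 : Real.log (t / x) = Real.log t - Real.log x := Real.log_div ht0.ne' hx.ne'
      rw [h3] at h2
      have h4 : (1 + 1 / s) * (t / x) ^ s = (t / x) ^ s + (t / x) ^ s / s := by ring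
      rw [h4]
      nlinarith
    have h5 : t ^ α * (t / x) ^ s ≤ x ^ α * (1 + t / x) ^ (1 + s) := by
      have h6 : t ^ α = x ^ α * (t / x) ^ α := by
        rw [← Real.mul_rpow hx.le htx, mul_div_cancel₀ _ hx.ne']
      rw [h6, mul_assoc, ← Real.rpow_add (by linarith)]
      gcongr
      exact (Real.rpow_le_rpow_of_exponent_le hv (by linarith)).trans
        (Real.rpow_le_rpow htx (by linarith) (by linarith))
    simp only [logPower, abs_of_pos ht0, abs_of_pos hx]
    rw [mul_div_assoc', div_mul_eq_mul_div, div_le_div_iff₀ (by linarith) (by linarith)]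
    have hta : 0 < t ^ α := Real.rpow_pos_of_pos ht0 _
    calc t ^ α * (1 - Real.log x)
        ≤ t ^ α * ((1 + 1 / s) * (t / x) ^ s * (1 - Real.log t)) := by gcongr
      _ = (1 + 1 / s) * (t ^ α * (t / x) ^ s) * (1 - Real.log t) := by ring
      _ ≤ (1 + 1 / s) * (x ^ α * (1 + t / x) ^ (1 + s)) * (1 - Real.log t) := by gcongr
      _ = _ := by ring

theorem abs_logPower_sub_le (hα : 0 < α) (hα1 : α ≤ 1) (hp : |p| ≤ 1) (hq : |q| ≤ 1) :
    |logPower α p - logPower α q| ≤ 2 * |p - q| ^ α := by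
  have key : ∀ p q : ℝ, 0 ≤ p → p ≤ q → q ≤ 1 →
      |logPower α q - logPower α p| ≤ 2 * |q - p| ^ α := by
    intro p q hp hpq hq1
    rw [abs_of_nonneg (sub_nonneg.2 (logPower_mono hα hα1 hp hpq hq1)),
      abs_of_nonneg (sub_nonneg.2 hpq)]
    refine (logPower_sub_le hα hα1 hp hpq hq1).trans ?_
    rcases (hp.trans hpq).eq_or_lt with rfl | hq
    · simp only [div_zero, mul_zero]
      have : 0 ≤ 0 - p := by linarith
      positivity
    have h1 := logPower_le_rpow (α := α) hq.le hq1
    have h0 : 0 ≤ (q - p) / q := div_nonneg (by linarith) hq.le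
    have h2 : (q - p) / q ≤ ((q - p) / q) ^ α := by
      rcases h0.eq_or_lt with h0 | h0
      · rw [← h0]
        positivity
      · simpa using Real.rpow_le_rpow_of_exponent_ge h0 ((div_le_one hq).2 (by linarith)) hα1
    have hqa : 0 < q ^ α := Real.rpow_pos_of_pos hq _
    calc 2 * logPower α q * ((q - p) / q) ≤ 2 * q ^ α * ((q - p) / q) ^ α := by gcongr
      _ = 2 * (q * ((q - p) / q)) ^ α := by rw [Real.mul_rpow hq.le h0]; ring
      _ = 2 * (q - p) ^ α := by rw [mul_div_cancel₀ _ hq.ne']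
  rw [← logPower_abs α p, ← logPower_abs α q]
  refine le_trans (b := 2 * |(|p| - |q|)| ^ α) ?_ ?_
  · rcases le_total |p| |q| with h | h
    · rw [abs_sub_comm, abs_sub_comm |p|]
      exact key _ _ (abs_nonneg _) h hq
    · exact key _ _ (abs_nonneg _) h hp
  · have := abs_abs_sub_abs_le p q
    gcongr

end LogPower

/-! ### The periodic profile -/

/-- The periodic profile with extrema of type `logPower α` at the multiples of `π / 2`. -/
noncomputable def periodicProfile (α x : ℝ) : ℝ := logPower α (Real.sin x) - logPower α (Real.cos x)

section PeriodicProfile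

variable {α s β : ℝ}

theorem periodicProfile_neg (α x : ℝ) : periodicProfile α (-x) = periodicProfile α x := by
  simp [periodicProfile, logPower_neg]

theorem periodicProfile_reflect (α x : ℝ) :
    periodicProfile α (Real.pi / 2 - x) = -periodicProfile α x := by
  simp [periodicProfile, Real.sin_pi_div_two_sub, Real.cos_pi_div_two_sub]

theorem periodicProfile_periodic (α : ℝ) : Function.Periodic (periodicProfile α) Real.pi := by
  intro x
  simp [periodicProfile, logPower_neg, Real.sin_add_pi, Real.cos_add_pi]

theorem periodicProfile_zero (hα : 0 < α) : periodicProfile α 0 = -1 := by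
  simp [periodicProfile, logPower_zero hα, logPower_one]

theorem abs_periodicProfile_le_one (hα : 0 < α) (x : ℝ) : |periodicProfile α x| ≤ 1 := by
  have h1 := logPower_nonneg (α := α) (Real.abs_sin_le_one x)
  have h2 := logPower_nonneg (α := α) (Real.abs_cos_le_one x)
  have h3 := logPower_le_one hα (Real.abs_sin_le_one x)
  have h4 := logPower_le_one hα (Real.abs_cos_le_one x)
  exact abs_le.2 ⟨by simp only [periodicProfile]; linarith,
    by simp only [periodicProfile]; linarith⟩

theorem abs_periodicProfile_sub_le (hα : 0 < α) (hα1 : α ≤ 1) (x y : ℝ) :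
    |periodicProfile α x - periodicProfile α y| ≤ 4 * min (|x - y| ^ α) 1 := by
  have b1 : |periodicProfile α x - periodicProfile α y| ≤ 4 * |x - y| ^ α := by
    have h1 := abs_logPower_sub_le hα hα1 (Real.abs_sin_le_one x) (Real.abs_sin_le_one y)
    have h2 := abs_logPower_sub_le hα hα1 (Real.abs_cos_le_one x) (Real.abs_cos_le_one y)
    have h3 : |Real.sin x - Real.sin y| ^ α ≤ |x - y| ^ α :=
      Real.rpow_le_rpow (abs_nonneg _) (Real.abs_sin_sub_sin_le x y) hα.le
    have h4 : |Real.cos x - Real.cos y| ^ α ≤ |x - y| ^ α :=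
      Real.rpow_le_rpow (abs_nonneg _) (Real.abs_cos_sub_cos_le x y) hα.le
    have h5 := abs_sub (logPower α (Real.sin x) - logPower α (Real.sin y))
      (logPower α (Real.cos x) - logPower α (Real.cos y))
    rw [sub_sub_sub_comm] at h5
    simp only [periodicProfile]
    linarith
  have b2 : |periodicProfile α x - periodicProfile α y| ≤ 4 * 1 := by
    refine (abs_sub _ _).trans ?_
    linarith [abs_periodicProfile_le_one hα x, abs_periodicProfile_le_one hα y]
  rw [mul_min_of_nonneg _ _ (by norm_num)]
  exact le_min b1 b2

theorem continuous_periodicProfile (hα : 0 < α) (hα1 : α ≤ 1) :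
    Continuous (periodicProfile α) := by
  rw [continuous_iff_continuousAt]
  intro x
  rw [ContinuousAt, tendsto_iff_dist_tendsto_zero]
  have h : Tendsto (fun y => 4 * |y - x| ^ α) (𝓝 x) (𝓝 (4 * |x - x| ^ α)) := by
    have : Continuous fun y : ℝ => 4 * |y - x| ^ α :=
      continuous_const.mul (Continuous.rpow_const (by fun_prop) fun _ => Or.inr hα.le)
    exact this.tendsto x
  rw [sub_self, abs_zero, Real.zero_rpow hα.ne', mul_zero] at h
  refine squeeze_zero (fun _ => dist_nonneg) (fun y => ?_) h
  rw [Real.dist_eq]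
  exact (abs_periodicProfile_sub_le hα hα1 y x).trans (by gcongr; exact min_le_left _ _)

theorem logPower_sin_le_periodicProfile_sub (hα : 0 < α) (w : ℝ) :
    logPower α (Real.sin w) ≤ periodicProfile α w - periodicProfile α 0 := by
  have := logPower_le_one hα (Real.abs_cos_le_one w)
  rw [periodicProfile_zero hα, periodicProfile]
  linarith

/-- The cosine term contributes `1 - φ(cos w) ≤ 1 - cos² w = sin² w ≤ φ(sin w)`. -/
theorem periodicProfile_sub_le (hα : 0 < α) (hα1 : α ≤ 1) (w : ℝ) :
    periodicProfile α w - periodicProfile α 0 ≤ 2 * logPower α (Real.sin w) := by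
  have h1 := sq_le_logPower hα hα1 (Real.abs_cos_le_one w)
  have h2 := sq_le_logPower hα hα1 (Real.abs_sin_le_one w)
  have h3 := Real.sin_sq_add_cos_sq w
  rw [periodicProfile_zero hα, periodicProfile]
  linarith

theorem periodicProfile_monotoneOn (hα : 0 < α) (hα1 : α ≤ 1) :
    MonotoneOn (periodicProfile α) (Icc 0 (Real.pi / 2)) := by
  intro x hx y hy hxy
  have hpi := Real.pi_pos
  have h1 := logPower_mono hα hα1 (Real.sin_nonneg_of_nonneg_of_le_pi hx.1 (by linarith [hx.2]))
    (Real.sin_le_sin_of_le_of_le_pi_div_two (by linarith [hx.1]) hy.2 hxy) (Real.sin_le_one y)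
  have h2 := logPower_mono hα hα1 (Real.cos_nonneg_of_mem_Icc ⟨by linarith [hy.1], hy.2⟩)
    (Real.cos_le_cos_of_nonneg_of_le_pi hx.1 (by linarith [hy.2]) hxy) (Real.cos_le_one x)
  simp only [periodicProfile]
  linarith

theorem half_le_sin {x : ℝ} (hx : 0 ≤ x) (hx1 : x ≤ Real.pi / 2) : x / 2 ≤ Real.sin x := by
  refine le_trans ?_ (Real.mul_le_sin hx hx1)
  have hpi := Real.pi_pos
  have : 1 / 2 ≤ 2 / Real.pi := by
    rw [div_le_div_iff₀ (by norm_num) hpi]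
    linarith [Real.pi_le_four]
  nlinarith

theorem half_le_cos {x : ℝ} (hx : 0 ≤ x) (hx1 : x ≤ Real.pi / 3) : 1 / 2 ≤ Real.cos x := by
  rw [← Real.cos_pi_div_three]
  exact Real.cos_le_cos_of_nonneg_of_le_pi hx (by linarith [Real.pi_pos]) hx1

theorem cos_sub_cos_le {w v : ℝ} (hw : 0 ≤ w) (hwv : w ≤ v) (hv : v ≤ Real.pi) :
    Real.cos w - Real.cos v ≤ v * (v - w) := by
  have h := Real.cos_sub_cos w v
  have e : Real.sin ((w - v) / 2) = -Real.sin ((v - w) / 2) := by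
    rw [← Real.sin_neg]
    congr 1
    ring
  rw [e] at h
  have h1 := Real.sin_le (by linarith : 0 ≤ (w + v) / 2)
  have h2 := Real.sin_le (by linarith : 0 ≤ (v - w) / 2)
  have h3 := Real.sin_nonneg_of_nonneg_of_le_pi (by linarith : 0 ≤ (v - w) / 2) (by linarith)
  have h4 : Real.sin ((w + v) / 2) * Real.sin ((v - w) / 2) ≤ v * ((v - w) / 2) :=
    mul_le_mul (by linarith) h2 h3 (by linarith)
  linarith

theorem le_sin_sub_sin {x y : ℝ} (hx : 0 ≤ x) (hxy : x ≤ y) (hy : y ≤ Real.pi / 4) :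
    (y - x) / 4 ≤ Real.sin y - Real.sin x := by
  have hpi := Real.pi_pos
  rw [Real.sin_sub_sin]
  have h1 := half_le_sin (by linarith : 0 ≤ (y - x) / 2) (by linarith)
  have h2 := half_le_cos (by linarith : 0 ≤ (y + x) / 2) (by linarith)
  nlinarith

theorem abs_periodicProfile_sub_le_of_scale (hα : 0 < α) (hα1 : α ≤ 1) (hs : 0 < s) (hs1 : s ≤ 1)
    {x w v : ℝ} (hx : 0 < x) (hx1 : x ≤ 1) (hw : 3 / 4 * x ≤ w) (hwv : w ≤ v)
    (hv : v ≤ 9 / 4 * x) (hv1 : v ≤ Real.pi / 3) :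
    |periodicProfile α v - periodicProfile α w| ≤
      100 * (1 + 1 / s) * logPower α x / x * (v - w) := by
  have hpi := Real.pi_pos
  have hw0 : 0 < w := by linarith
  have hv0 : 0 < v := by linarith
  rw [abs_of_nonneg (sub_nonneg.2 (periodicProfile_monotoneOn hα hα1 ⟨hw0.le, by linarith⟩
    ⟨hv0.le, by linarith⟩ hwv))]
  have hφ := logPower_pos (α := α) hx hx1
  have hsv : 3 / 8 * x ≤ Real.sin v := by
    linarith [half_le_sin hv0.le (by linarith : v ≤ Real.pi / 2)]
  have hsw : 0 ≤ Real.sin w := Real.sin_nonneg_of_nonneg_of_le_pi hw0.le (by linarith)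
  have hswv : Real.sin w ≤ Real.sin v :=
    Real.sin_le_sin_of_le_of_le_pi_div_two (by linarith) (by linarith) hwv
  have hdiff : Real.sin v - Real.sin w ≤ v - w := by
    have := Real.abs_sin_sub_sin_le v w
    rwa [abs_of_nonneg (sub_nonneg.2 hswv), abs_of_nonneg (sub_nonneg.2 hwv)] at this
  have hgrow : logPower α (Real.sin v) ≤ 16 * ((1 + 1 / s) * logPower α x) := by
    have h1 := logPower_growth hα hα1 hs hx hx1 (hsw.trans hswv) (Real.sin_le_one v)
    have h2 : Real.sin v / x ≤ 3 := by
      rw [div_le_iff₀ hx]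
      linarith [Real.sin_le hv0.le]
    have h20 : 0 ≤ Real.sin v / x := div_nonneg (hsw.trans hswv) hx.le
    have h3 : (1 + Real.sin v / x) ^ (1 + s) ≤ 16 := by
      calc (1 + Real.sin v / x) ^ (1 + s) ≤ 4 ^ (1 + s) :=
            Real.rpow_le_rpow (by linarith) (by linarith) (by linarith)
        _ ≤ 4 ^ (2 : ℝ) := Real.rpow_le_rpow_of_exponent_le (by norm_num) (by linarith)
        _ = 16 := by norm_num
    have h4 : 0 ≤ (1 + 1 / s) * logPower α x := by positivity
    nlinarith
  have b1 : logPower α (Real.sin v) - logPower α (Real.sin w) ≤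
      2 * (16 * ((1 + 1 / s) * logPower α x)) * ((v - w) / (3 / 8 * x)) := by
    refine (logPower_sub_le hα hα1 hsw hswv (Real.sin_le_one v)).trans ?_
    have : 0 ≤ Real.sin v - Real.sin w := by linarith
    have : 0 < Real.sin v := by linarith
    gcongr
  have hcw := half_le_cos hw0.le (hwv.trans hv1)
  have hcv := half_le_cos hv0.le hv1
  have hcwv : Real.cos v ≤ Real.cos w :=
    Real.cos_le_cos_of_nonneg_of_le_pi hw0.le (by linarith) hwv
  have hcos := cos_sub_cos_le hw0.le hwv (by linarith)
  -- The cosine varies with slope of order `x` here, and `x² ≤ φ(x)` makes this negligible against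
  -- the slope `φ(x)/x` of the sine term.
  have hxφ : x ≤ logPower α x / x := by
    rw [le_div_iff₀ hx]
    have := sq_le_logPower hα hα1 (t := x) (by rwa [abs_of_pos hx])
    linarith
  have b2 : logPower α (Real.cos w) - logPower α (Real.cos v) ≤
      9 * (logPower α x / x) * (v - w) := by
    refine (logPower_sub_le hα hα1 (by linarith) hcwv (Real.cos_le_one w)).trans ?_
    have h1 := logPower_le_one hα (Real.abs_cos_le_one w)
    have h2 := logPower_nonneg (α := α) (Real.abs_cos_le_one w)
    have h3 : (Real.cos w - Real.cos v) / Real.cos w ≤ 2 * (v * (v - w)) := by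
      rw [div_le_iff₀ (by linarith)]
      nlinarith
    have h5 : v * (v - w) ≤ 9 / 4 * (logPower α x / x) * (v - w) :=
      mul_le_mul_of_nonneg_right (by linarith) (by linarith)
    have h6 : 0 ≤ (Real.cos w - Real.cos v) / Real.cos w :=
      div_nonneg (by linarith) (by linarith)
    nlinarith
  have hs2 : 1 ≤ 1 + 1 / s := by
    have : 0 < 1 / s := by positivity
    linarith
  have e1 : 2 * (16 * ((1 + 1 / s) * logPower α x)) * ((v - w) / (3 / 8 * x)) =
      256 / 3 * ((1 + 1 / s) * (logPower α x / x * (v - w))) := by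
    field_simp
    ring
  have hN : 0 ≤ logPower α x / x * (v - w) := mul_nonneg (by positivity) (by linarith)
  have e2 : logPower α x / x * (v - w) ≤ (1 + 1 / s) * (logPower α x / x * (v - w)) :=
    le_mul_of_one_le_left hN hs2
  have e3 : 100 * (1 + 1 / s) * logPower α x / x * (v - w) =
      100 * ((1 + 1 / s) * (logPower α x / x * (v - w))) := by ring
  rw [e3]
  simp only [periodicProfile]
  linarith

/-- The cosine term only increases the difference. The factor `1/32` collects `1/4` from `φ(x/2) ≥
φ(x)/4`, `1/4` from the sine increment and `1/2` from `sin y ≤ 2x`. -/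
theorem le_periodicProfile_sub_of_scale (hα : 0 < α) (hα1 : α ≤ 1) {x y : ℝ} (hx : 0 < x)
    (hxy : x ≤ y) (hy : y ≤ Real.pi / 4) (hy2 : y ≤ 2 * x) :
    α / 32 * logPower α x * ((y - x) / x) ≤ periodicProfile α y - periodicProfile α x := by
  have hpi := Real.pi_pos
  have hx1 : x ≤ 1 := by linarith [Real.pi_le_four]
  have hsx := half_le_sin hx.le (by linarith)
  have hsy := half_le_sin (hx.le.trans hxy) (by linarith)
  have hsxy : Real.sin x ≤ Real.sin y :=
    Real.sin_le_sin_of_le_of_le_pi_div_two (by linarith) (by linarith) hxy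
  have h1 := le_logPower_sub hα hα1 (by linarith : 0 < Real.sin x) hsxy (Real.sin_le_one y)
  have h2 := logPower_mono hα hα1
    (Real.cos_nonneg_of_mem_Icc ⟨by linarith, by linarith⟩)
    (Real.cos_le_cos_of_nonneg_of_le_pi hx.le (by linarith) hxy) (Real.cos_le_one x)
  have h3 : 1 / 4 * logPower α x ≤ logPower α (Real.sin x) := by
    refine le_trans ?_ (logPower_mono hα hα1 (by linarith : 0 ≤ x / 2) hsx (Real.sin_le_one x))
    refine le_trans (le_of_eq ?_) (sq_ratio_mul_logPower_le hα1 (by linarith : 0 < x / 2)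
      (by linarith) hx1)
    congr 1
    field_simp
    norm_num
  have h4 : (y - x) / 4 / (2 * x) ≤ (Real.sin y - Real.sin x) / Real.sin y :=
    div_le_div₀ (by linarith) (le_sin_sub_sin hx.le hxy hy) (by linarith)
      ((Real.sin_le (hx.le.trans hxy)).trans hy2)
  have hφ := logPower_pos (α := α) hx hx1
  have h5 : 0 ≤ (y - x) / 4 / (2 * x) := div_nonneg (by linarith) (by linarith)
  have h6 : α * (1 / 4 * logPower α x) * ((y - x) / 4 / (2 * x)) ≤
      α * logPower α (Real.sin x) * ((Real.sin y - Real.sin x) / Real.sin y) := by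
    have : 0 ≤ logPower α (Real.sin x) := logPower_nonneg (Real.abs_sin_le_one x)
    gcongr
  have h7 : α * (1 / 4 * logPower α x) * ((y - x) / 4 / (2 * x)) =
      α / 32 * logPower α x * ((y - x) / x) := by
    field_simp
    ring
  simp only [periodicProfile]
  linarith

theorem dyadicProfile_periodicProfile (hα : 0 < α) (hα1 : α ≤ 1) (hs : 0 < s) (hs1 : s ≤ 1) :
    DyadicProfile s (Real.pi / 4) (100 * (1 + 1 / s)) (α / 32) (logPower α)
      (periodicProfile α) := by
  have hpi := Real.pi_pos
  have hone : ∀ x, x ≤ Real.pi / 4 → x ≤ 1 := fun x hx => by linarith [Real.pi_le_four]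
  refine ⟨fun x hx hxa => logPower_pos hx (hone x hxa), ?_, ?_, ?_, ?_⟩
  · exact (periodicProfile_monotoneOn hα hα1).mono (Icc_subset_Icc_right (by linarith))
  · intro x hx hxa w
    have h0 := (logPower_nonneg (α := α) (Real.abs_sin_le_one w)).trans
      (logPower_sin_le_periodicProfile_sub hα w)
    rw [abs_of_nonneg h0]
    refine (periodicProfile_sub_le hα hα1 w).trans ?_
    rw [← logPower_abs]
    have h1 := logPower_growth hα hα1 hs hx (hone x hxa) (abs_nonneg _) (Real.abs_sin_le_one w)
    have h2 : |Real.sin w| ≤ |w| := Real.abs_sin_le_abs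
    have hφ := logPower_pos (α := α) hx (hone x hxa)
    have h3 : (1 + |Real.sin w| / x) ^ (1 + s) ≤ (1 + |w| / x) ^ (1 + s) := by
      gcongr
    have h4 : 0 ≤ (1 + 1 / s) * logPower α x := by positivity
    have h5 : 0 ≤ (1 + |w| / x) ^ (1 + s) := by positivity
    have h6 := mul_le_mul_of_nonneg_left h3 h4
    have h7 := mul_nonneg h4 h5
    linarith
  · intro x y hx hxy hya hy2 w hw v hv
    have key : ∀ w v, 3 / 4 * x ≤ w → w ≤ v → v ≤ y + x / 4 →
        |periodicProfile α v - periodicProfile α w| ≤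
          100 * (1 + 1 / s) * logPower α x / x * (v - w) := fun w v hw hwv hv =>
      abs_periodicProfile_sub_le_of_scale hα hα1 hs hs1 hx (hone x (hxy.trans hya)) hw hwv
        (by linarith) (by linarith)
    rcases le_total w v with h | h
    · rw [abs_sub_comm, abs_sub_comm w, abs_of_nonneg (sub_nonneg.2 h)]
      exact key w v hw.1 h hv.2
    · rw [abs_of_nonneg (sub_nonneg.2 h)]
      exact key v w hv.1 h hw.2
  · intro x y hx hxy hya hy2
    exact le_periodicProfile_sub_of_scale hα hα1 hx hxy hya hy2

end PeriodicProfile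

/-! ### Continuous differentiability in the endpoint case -/

section Differentiability

/-- The derivative of `logPower 1`. -/
noncomputable def logPowerOneDeriv (t : ℝ) : ℝ :=
  SignType.sign t * (1 / (1 - Real.log t) + 1 / (1 - Real.log t) ^ 2)

theorem tendsto_inv_one_sub_log_zero :
    Tendsto (fun t : ℝ => 1 / (1 - Real.log t)) (𝓝[≠] 0) (𝓝 0) := by
  have h : Tendsto (fun t : ℝ => 1 - Real.log t) (𝓝[≠] 0) atTop := by
    simpa [sub_eq_add_neg] using
      tendsto_atTop_add_const_left _ (1 : ℝ) (tendsto_neg_atBot_atTop.comp Real.tendsto_log_nhdsNE_zero)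
  simp only [one_div]
  exact h.inv_tendsto_atTop

theorem one_sub_log_pos_of_abs {t : ℝ} (ht : |t| ≤ 1) : 0 < 1 - Real.log t := by
  have := one_le_one_sub_log (abs_nonneg t) ht
  rw [Real.log_abs] at this
  linarith

/-- At the origin the difference quotient is `±1/(1 - log |t|)`, which tends to zero; this is the
purpose of the logarithm. -/
theorem hasDerivAt_logPower_one {t : ℝ} (ht : |t| ≤ 1) :
    HasDerivAt (logPower 1) (logPowerOneDeriv t) t := by
  rcases eq_or_ne t 0 with rfl | h0
  · rw [hasDerivAt_iff_tendsto_slope_zero]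
    simp only [logPowerOneDeriv, sign_zero, SignType.coe_zero, zero_mul]
    refine squeeze_zero_norm' (a := fun t : ℝ => |1 / (1 - Real.log t)|) ?_
      (by simpa using tendsto_inv_one_sub_log_zero.abs)
    filter_upwards [self_mem_nhdsWithin] with t ht
    have ht0 : |t| ≠ 0 := abs_ne_zero.2 ht
    rw [zero_add, logPower_zero one_pos, sub_zero, logPower, Real.rpow_one, norm_smul, norm_inv,
      norm_div, Real.norm_eq_abs, Real.norm_eq_abs, Real.norm_eq_abs, abs_abs, abs_div, abs_one]
    refine le_of_eq ?_
    field_simp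
  · have hL := (one_sub_log_pos_of_abs ht).ne'
    have h1 := (hasDerivAt_abs h0).div ((Real.hasDerivAt_log h0).const_sub 1) hL
    have h2 : logPower 1 = fun t => |t| / (1 - Real.log t) := by
      funext t
      rw [logPower, Real.rpow_one]
    rw [h2]
    refine h1.congr_deriv ?_
    rw [logPowerOneDeriv]
    rcases lt_or_gt_of_ne h0 with h | h
    · simp only [sign_neg h, abs_of_neg h, SignType.coe_neg_one]
      field_simp
      ring
    · simp only [sign_pos h, abs_of_pos h, SignType.coe_one]
      field_simp
      ring

theorem continuousAt_logPowerOneDeriv {t : ℝ} (ht : |t| ≤ 1) :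
    ContinuousAt logPowerOneDeriv t := by
  rcases eq_or_ne t 0 with rfl | h0
  · rw [← continuousWithinAt_compl_self, ContinuousWithinAt]
    have h1 : logPowerOneDeriv 0 = 0 := by simp [logPowerOneDeriv]
    rw [h1]
    have h2 := (tendsto_inv_one_sub_log_zero.add (tendsto_inv_one_sub_log_zero.pow 2)).abs
    rw [zero_pow two_ne_zero, add_zero, abs_zero] at h2
    refine squeeze_zero_norm (fun t => ?_) h2
    rw [logPowerOneDeriv, norm_mul, Real.norm_eq_abs, Real.norm_eq_abs, div_pow, one_pow]
    refine mul_le_of_le_one_left (abs_nonneg _) ?_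
    rcases lt_trichotomy t 0 with h | h | h <;> simp [h]
  · have hL := (one_sub_log_pos_of_abs ht).ne'
    have hs : ContinuousAt (fun t : ℝ => ((SignType.sign t : SignType) : ℝ)) t := by
      have : ContinuousAt (fun t : ℝ => t / |t|) t :=
        continuousAt_id.div continuous_abs.continuousAt (abs_ne_zero.2 h0)
      refine this.congr ?_
      filter_upwards [isOpen_ne.mem_nhds h0] with v hv
      rcases lt_or_gt_of_ne hv with h | h
      · simp [h, abs_of_neg h, div_neg, div_self h.ne]
      · simp [h, abs_of_pos h, div_self h.ne']
    have hl : ContinuousAt (fun t => 1 - Real.log t) t :=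
      continuousAt_const.sub (Real.continuousAt_log h0)
    exact hs.mul ((continuousAt_const.div hl hL).add
      (continuousAt_const.div (hl.pow 2) (pow_ne_zero 2 hL)))

theorem abs_logPowerOneDeriv_le {t : ℝ} (ht : |t| ≤ 1) : |logPowerOneDeriv t| ≤ 2 := by
  have hL := one_le_one_sub_log (abs_nonneg t) ht
  rw [Real.log_abs] at hL
  have h1 : 1 / (1 - Real.log t) ≤ 1 := by
    rw [div_le_one (by linarith)]
    exact hL
  have h2 : 1 / (1 - Real.log t) ^ 2 ≤ 1 := by
    rw [div_le_one (by positivity)]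
    exact one_le_pow₀ hL
  have h3 : 0 ≤ 1 / (1 - Real.log t) + 1 / (1 - Real.log t) ^ 2 := by positivity
  rw [logPowerOneDeriv, abs_mul, abs_of_nonneg h3]
  refine (mul_le_of_le_one_left h3 ?_).trans (by linarith)
  rcases lt_trichotomy t 0 with h | h | h <;> simp [h]

theorem hasDerivAt_periodicProfile_one (x : ℝ) :
    HasDerivAt (periodicProfile 1) (logPowerOneDeriv (Real.sin x) * Real.cos x -
      logPowerOneDeriv (Real.cos x) * -Real.sin x) x :=
  ((hasDerivAt_logPower_one (Real.abs_sin_le_one x)).comp x (Real.hasDerivAt_sin x)).sub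
    ((hasDerivAt_logPower_one (Real.abs_cos_le_one x)).comp x (Real.hasDerivAt_cos x))

theorem deriv_periodicProfile_one : deriv (periodicProfile 1) = fun x =>
    logPowerOneDeriv (Real.sin x) * Real.cos x - logPowerOneDeriv (Real.cos x) * -Real.sin x :=
  funext fun x => (hasDerivAt_periodicProfile_one x).deriv

theorem abs_deriv_periodicProfile_one_le (x : ℝ) : |deriv (periodicProfile 1) x| ≤ 4 := by
  rw [deriv_periodicProfile_one]
  have h1 := abs_logPowerOneDeriv_le (Real.abs_sin_le_one x)
  have h2 := abs_logPowerOneDeriv_le (Real.abs_cos_le_one x)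
  refine (abs_sub _ _).trans ?_
  rw [abs_mul, abs_mul, abs_neg]
  have h3 := mul_le_mul h1 (Real.abs_cos_le_one x) (abs_nonneg _) (by norm_num)
  have h4 := mul_le_mul h2 (Real.abs_sin_le_one x) (abs_nonneg _) (by norm_num)
  linarith

theorem contDiff_periodicProfile_one : ContDiff ℝ 1 (periodicProfile 1) := by
  rw [contDiff_one_iff_deriv]
  refine ⟨fun x => (hasDerivAt_periodicProfile_one x).differentiableAt, ?_⟩
  rw [deriv_periodicProfile_one, continuous_iff_continuousAt]
  intro x
  have h1 : ContinuousAt (fun x => logPowerOneDeriv (Real.sin x)) x :=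
    ContinuousAt.comp (f := Real.sin) (continuousAt_logPowerOneDeriv (Real.abs_sin_le_one x))
      Real.continuous_sin.continuousAt
  have h2 : ContinuousAt (fun x => logPowerOneDeriv (Real.cos x)) x :=
    ContinuousAt.comp (f := Real.cos) (continuousAt_logPowerOneDeriv (Real.abs_cos_le_one x))
      Real.continuous_cos.continuousAt
  exact (h1.mul Real.continuous_cos.continuousAt).sub
    (h2.mul Real.continuous_sin.continuousAt.neg)

end Differentiability

/-! ### Membership and failure of Hölder regularity -/

section HolderClass

theorem holderClass_of_lt_one {γ B C : ℝ} {g : ℝ → ℝ} (hγ1 : γ < 1)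
    (hc : Continuous g) (hB : ∀ x, |g x| ≤ B) (hC : ∀ x y, |g x - g y| ≤ C * |x - y| ^ γ) :
    HolderClass γ univ g := by
  have hfl : ⌊γ⌋₊ = 0 := Nat.floor_eq_zero.2 hγ1
  refine ⟨?_, ?_, C, fun x _ y _ => ?_⟩
  · rw [hfl]
    exact contDiffOn_zero.2 hc.continuousOn
  · intro k hk
    obtain rfl : k = 0 := by omega
    exact ⟨B, fun x _ => by simpa using hB x⟩
  · rw [hfl]
    simpa using hC x y

theorem holderClass_periodicProfile {α : ℝ} (hα : 0 < α) (hα1 : α ≤ 1) :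
    HolderClass α univ (periodicProfile α) := by
  rcases hα1.lt_or_eq with hα1' | rfl
  · refine holderClass_of_lt_one (B := 1) (C := 4) hα1' (continuous_periodicProfile hα hα1)
      (abs_periodicProfile_le_one hα) fun x y => ?_
    exact (abs_periodicProfile_sub_le hα hα1 x y).trans (by gcongr; exact min_le_left _ _)
  · have hfl : ⌊(1 : ℝ)⌋₊ = 1 := Nat.floor_one
    -- At `α = 1` the Hölder index of the derivative is `0`, so twice its bound `4` suffices.
    refine ⟨?_, ?_, 8, fun x _ y _ => ?_⟩
    · rw [hfl]
      exact contDiff_periodicProfile_one.contDiffOn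
    · intro k hk
      rw [hfl] at hk
      interval_cases k
      · exact ⟨1, fun x _ => by simpa using abs_periodicProfile_le_one one_pos x⟩
      · refine ⟨4, fun x _ => ?_⟩
        rw [iteratedDerivWithin_univ, iteratedDeriv_one]
        exact abs_deriv_periodicProfile_one_le x
    · rw [hfl, iteratedDerivWithin_univ, iteratedDeriv_one, Nat.cast_one, sub_self, Real.rpow_zero]
      refine (abs_sub _ _).trans ?_
      linarith [abs_deriv_periodicProfile_one_le x, abs_deriv_periodicProfile_one_le y]

/-- At an interior minimum a function of class `C^γ` grows at most like a power `γ`, or like a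
square when `γ ≥ 2`. -/
theorem exists_rpow_growth_of_holderClass {γ ρ : ℝ} {g : ℝ → ℝ} (hρ : 0 < ρ)
    (hmin : ∀ x, g 0 ≤ g x) (hg : HolderClass γ (Icc (-ρ) ρ) g) :
    ∃ C, ∀ x ∈ Ioc 0 ρ, g x - g 0 ≤ C * x ^ (min γ 2) := by
  obtain ⟨hcd, hbd, C, hC⟩ := hg
  set I := Icc (-ρ) ρ with hI
  have h0I : (0 : ℝ) ∈ I := ⟨by linarith, hρ.le⟩
  rcases lt_or_ge γ 1 with hγ | hγ
  · rw [Nat.floor_eq_zero.2 hγ] at hC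
    refine ⟨C, fun x hx => ?_⟩
    have h := hC x ⟨by linarith [hx.1], hx.2⟩ 0 h0I
    simp only [iteratedDerivWithin_zero, Nat.cast_zero, sub_zero, abs_of_pos hx.1] at h
    rw [min_eq_left (by linarith)]
    exact (le_abs_self _).trans h
  have hfl1 : 1 ≤ ⌊γ⌋₊ := (Nat.one_le_floor_iff γ).2 hγ
  have hu : UniqueDiffOn ℝ I := uniqueDiffOn_Icc (by linarith)
  have hd0 : derivWithin g I 0 = 0 := by
    rw [derivWithin_of_mem_nhds (Icc_mem_nhds (by linarith) hρ)]
    exact IsLocalMin.deriv_eq_zero (Eventually.of_forall hmin)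
  have hdiff : DifferentiableOn ℝ g I := hcd.differentiableOn (by
    have : ⌊γ⌋₊ ≠ 0 := by omega
    exact_mod_cast this)
  -- The derivative vanishes at the interior minimum; integrating its Hölder or Lipschitz bound
  -- gains one power.
  have hgrowth : ∃ K, 0 ≤ K ∧ ∀ x ∈ I, |derivWithin g I x| ≤ K * |x| ^ (min γ 2 - 1) := by
    rcases lt_or_ge γ 2 with hγ2 | hγ2
    · have hfl : ⌊γ⌋₊ = 1 := (Nat.floor_eq_iff (by linarith)).2 ⟨by simpa using hγ, by
        norm_num; exact hγ2⟩
      rw [hfl] at hC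
      refine ⟨|C|, abs_nonneg _, fun x hx => ?_⟩
      have h := hC x hx 0 h0I
      rw [iteratedDerivWithin_one, hd0, sub_zero, sub_zero, Nat.cast_one] at h
      rw [min_eq_left hγ2.le]
      refine h.trans ?_
      gcongr
      exact le_abs_self C
    · have hfl : 2 ≤ ⌊γ⌋₊ := Nat.le_floor (by exact_mod_cast hγ2)
      obtain ⟨M, hM⟩ := hbd 2 hfl
      have hdd : DifferentiableOn ℝ (iteratedDerivWithin 1 g I) I :=
        hcd.differentiableOn_iteratedDerivWithin (by
          have : 1 < ⌊γ⌋₊ := by omega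
          exact_mod_cast this) hu
      refine ⟨|M|, abs_nonneg _, fun x hx => ?_⟩
      have h := (convex_Icc (-ρ) ρ).norm_image_sub_le_of_norm_derivWithin_le hdd (C := |M|)
        (fun y hy => ?_) h0I hx
      · rw [iteratedDerivWithin_one, hd0, sub_zero, sub_zero] at h
        rw [min_eq_right hγ2]
        norm_num
        exact h
      · rw [← iteratedDerivWithin_succ]
        exact (hM y hy).trans (le_abs_self M)
  obtain ⟨K, hK, hgK⟩ := hgrowth
  have hm : 0 ≤ min γ 2 - 1 := sub_nonneg.2 (le_min hγ one_le_two)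
  refine ⟨K, fun x hx => ?_⟩
  have hsub : Icc 0 x ⊆ I := Icc_subset_Icc (by linarith) hx.2
  have h := (convex_Icc 0 x).norm_image_sub_le_of_norm_hasDerivWithin_le
    (C := K * x ^ (min γ 2 - 1))
    (fun y hy => ((hdiff y (hsub hy)).hasDerivWithinAt.mono hsub))
    (fun y hy => ?_) (left_mem_Icc.2 hx.1.le) (right_mem_Icc.2 hx.1.le)
  · rw [Real.norm_eq_abs, Real.norm_eq_abs, sub_zero, abs_of_pos hx.1, mul_assoc,
      ← Real.rpow_add_one hx.1.ne', sub_add_cancel] at h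
    exact (le_abs_self _).trans h
  · refine (hgK y (hsub hy)).trans ?_
    rw [abs_of_nonneg hy.1]
    have := Real.rpow_le_rpow hy.1 hy.2 hm
    gcongr

/-- Class `C^(α+ε)` would force `φ(sin x) ≤ C x^(α+η)` with `η > 0`, and a power of `x` beats `1 -
log x`. Capping at `2` is harmless since `α ≤ 1`. -/
theorem not_holderClass_periodicProfile {α ε ρ : ℝ} (hα : 0 < α) (hα1 : α ≤ 1) (hε : 0 < ε)
    (hρ : 0 < ρ) : ¬ HolderClass (α + ε) (Icc (-ρ) ρ) (periodicProfile α) := by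
  intro hcls
  obtain ⟨C, hC⟩ := exists_rpow_growth_of_holderClass hρ (fun x => sub_nonneg.1
    ((logPower_nonneg (Real.abs_sin_le_one x)).trans
      (logPower_sin_le_periodicProfile_sub hα x))) hcls
  set η := min (α + ε) 2 - α with hη
  have hη0 : 0 < η := sub_pos.2 (lt_min (by linarith) (by linarith))
  have hlow : ∀ x, 0 < x → x ≤ min ρ 1 → 1 ≤ 4 * C * (x ^ η - Real.log x * x ^ η) := by
    intro x hx hxle
    have hx1 : x ≤ 1 := hxle.trans (min_le_right _ _)
    have hxpi : x ≤ Real.pi / 2 := by linarith [Real.pi_gt_three]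
    have h1 := hC x ⟨hx, hxle.trans (min_le_left _ _)⟩
    have h2 := logPower_sin_le_periodicProfile_sub hα x
    have h3 := logPower_mono hα hα1 (by linarith : 0 ≤ x / 2) (half_le_sin hx.le hxpi)
      (Real.sin_le_one x)
    have h4 := sq_ratio_mul_logPower_le hα1 (by linarith : 0 < x / 2) (by linarith) hx1
    have h5 : (x / 2 / x) ^ 2 = 1 / 4 := by
      field_simp
      norm_num
    have hL := one_le_one_sub_log hx.le hx1
    have hxa : 0 < x ^ α := Real.rpow_pos_of_pos hx _
    have h6 : x ^ (min (α + ε) 2) = x ^ α * x ^ η := by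
      rw [← Real.rpow_add hx, hη, add_sub_cancel]
    rw [h5] at h4
    rw [h6] at h1
    have h7 : x ^ α / (1 - Real.log x) ≤ 4 * (C * (x ^ α * x ^ η)) := by
      have : logPower α x = x ^ α / (1 - Real.log x) := by rw [logPower, abs_of_pos hx]
      linarith
    rw [div_le_iff₀ (by linarith)] at h7
    refine le_of_mul_le_mul_left (le_trans (le_of_eq (mul_one _)) (h7.trans (le_of_eq ?_))) hxa
    ring
  have ht1 : Tendsto (fun x : ℝ => x ^ η) (𝓝[>] 0) (𝓝 0) := by
    have h : Continuous fun x : ℝ => x ^ η :=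
      continuous_id.rpow_const fun _ => Or.inr hη0.le
    have h0 := h.tendsto 0
    rw [Real.zero_rpow hη0.ne'] at h0
    exact h0.mono_left nhdsWithin_le_nhds
  have ht : Tendsto (fun x : ℝ => 4 * C * (x ^ η - Real.log x * x ^ η)) (𝓝[>] 0) (𝓝 0) := by
    simpa using (ht1.sub (tendsto_log_mul_rpow_nhdsGT_zero hη0)).const_mul (4 * C)
  have hev : ∀ᶠ x : ℝ in 𝓝[>] 0, 1 ≤ 4 * C * (x ^ η - Real.log x * x ^ η) := by
    filter_upwards [Ioc_mem_nhdsGT (lt_min hρ one_pos)] with x hx using hlow x hx.1 hx.2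
  exact absurd (ge_of_tendsto ht hev) (by norm_num)

end HolderClass

/-! ### Global control and construction of the nonlinearity -/

section Nonlinearity

variable {α s β : ℝ}

theorem exists_holder_control_periodicProfile (hα : 0 < α) (hα1 : α ≤ 1) (hs : 0 < s)
    (hs1 : 2 * s < 1) (hsα : 2 * s < α) (hβ : 0 < β) (hβs : β ≤ 1 - 2 * s)
    (hscale : 2 * s = α * (1 - β)) :
    ∃ K, 0 ≤ K ∧ ∀ x y,
      |fracIntegral s (periodicProfile α) x - fracIntegral s (periodicProfile α) y| ≤
        K * |periodicProfile α x - periodicProfile α y| ^ β := by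
  have hpi := Real.pi_pos
  obtain ⟨K, hK, hloc⟩ :=
    (dyadicProfile_periodicProfile hα hα1 hs (by linarith)).holder hs hs1 hsα hβ hβs
      (by positivity) (by positivity) (continuous_periodicProfile hα hα1)
      (abs_periodicProfile_sub_le hα hα1) (fun x hx hxa => by
        have hx1 : x ≤ 1 := by linarith [Real.pi_le_four]
        rw [hscale, Real.rpow_mul hx.le]
        exact Real.rpow_le_rpow (logPower_pos hx hx1).le (logPower_le_rpow hx.le hx1)
          (by linarith))
  set u := periodicProfile α with hu
  set H := fracIntegral s u with hH
  -- Oddness about `π/4` carries the estimate from the minimum at `0` to the maximum at `π/2`.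
  have hHr : ∀ x, H (Real.pi / 2 - x) = -H x :=
    fracIntegral_sub_of_odd (periodicProfile_reflect α)
  have hur : ∀ x, u (Real.pi / 2 - x) = -u x := periodicProfile_reflect α
  have hmono := periodicProfile_monotoneOn hα hα1
  have hmid : Real.pi / 4 ∈ Icc 0 (Real.pi / 4) := ⟨by linarith, le_rfl⟩
  have hupper : ∀ x ∈ Icc (Real.pi / 4) (Real.pi / 2), ∀ y ∈ Icc (Real.pi / 4) (Real.pi / 2),
      |H x - H y| ≤ K * |u x - u y| ^ β := by
    intro x hx y hy
    have h := hloc (Real.pi / 2 - x) ⟨by linarith [hx.2], by linarith [hx.1]⟩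
      (Real.pi / 2 - y) ⟨by linarith [hy.2], by linarith [hy.1]⟩
    rw [hHr, hHr, hur, hur, ← neg_sub', ← neg_sub', abs_neg, abs_neg] at h
    exact h
  have hcross : ∀ x ∈ Icc 0 (Real.pi / 4), ∀ y ∈ Icc (Real.pi / 4) (Real.pi / 2),
      |H x - H y| ≤ 2 * K * |u x - u y| ^ β := by
    intro x hx y hy
    have h1 := hloc x hx _ hmid
    have h2 := hupper _ ⟨le_rfl, by linarith⟩ y hy
    have m1 : u x ≤ u (Real.pi / 4) := hmono ⟨hx.1, by linarith [hx.2]⟩ ⟨by linarith, by linarith⟩ hx.2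
    have m2 : u (Real.pi / 4) ≤ u y := hmono ⟨by linarith, by linarith⟩ ⟨by linarith [hy.1], hy.2⟩ hy.1
    have e1 : |u x - u (Real.pi / 4)| ^ β ≤ |u x - u y| ^ β := by
      refine Real.rpow_le_rpow (abs_nonneg _) ?_ hβ.le
      rw [abs_of_nonpos (by linarith), abs_of_nonpos (by linarith)]
      linarith
    have e2 : |u (Real.pi / 4) - u y| ^ β ≤ |u x - u y| ^ β := by
      refine Real.rpow_le_rpow (abs_nonneg _) ?_ hβ.le
      rw [abs_of_nonpos (by linarith), abs_of_nonpos (by linarith)]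
      linarith
    have := abs_sub_le (H x) (H (Real.pi / 4)) (H y)
    have := mul_le_mul_of_nonneg_left e1 hK
    have := mul_le_mul_of_nonneg_left e2 hK
    linarith
  have hle : ∀ x y, K * |u x - u y| ^ β ≤ 2 * K * |u x - u y| ^ β := by
    intro x y
    gcongr
    linarith
  have hfund : ∀ x ∈ Icc 0 (Real.pi / 2), ∀ y ∈ Icc 0 (Real.pi / 2),
      |H x - H y| ≤ 2 * K * |u x - u y| ^ β := by
    intro x hx y hy
    rcases le_total x (Real.pi / 4) with h1 | h1 <;> rcases le_total y (Real.pi / 4) with h2 | h2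
    · exact (hloc x ⟨hx.1, h1⟩ y ⟨hy.1, h2⟩).trans (hle x y)
    · exact hcross x ⟨hx.1, h1⟩ y ⟨h2, hy.2⟩
    · rw [abs_sub_comm, abs_sub_comm (u x)]
      exact hcross y ⟨hy.1, h2⟩ x ⟨h1, hx.2⟩
    · exact (hupper x ⟨h1, hx.2⟩ y ⟨h2, hy.2⟩).trans (hle x y)
  -- Periodicity moves any point into `[-π/2, π/2]` and evenness folds it; neither changes `u` or
  -- `H`.
  have hred : ∀ x, ∃ x' ∈ Icc 0 (Real.pi / 2), u x' = u x ∧ H x' = H x := by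
    intro x
    have hup : Function.Periodic u Real.pi := periodicProfile_periodic α
    have hHp : Function.Periodic H Real.pi := fracIntegral_periodic hup
    have hue : ∀ z, u (-z) = u z := periodicProfile_neg α
    have hHe : ∀ z, H (-z) = H z := fracIntegral_neg_of_even hue
    set r := x - round (x / Real.pi) * Real.pi with hr
    have hur : u r = u x := hup.sub_int_mul_eq _
    have hHr : H r = H x := hHp.sub_int_mul_eq _
    have habs : |r| ≤ Real.pi / 2 := by
      have h := abs_sub_round (x / Real.pi)
      have e : r = (x / Real.pi - round (x / Real.pi)) * Real.pi := by
        rw [hr, sub_mul, div_mul_cancel₀ _ hpi.ne']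
      rw [e, abs_mul, abs_of_pos hpi]
      nlinarith
    refine ⟨|r|, ⟨abs_nonneg r, habs⟩, ?_⟩
    rcases abs_choice r with h | h <;> rw [h]
    · exact ⟨hur, hHr⟩
    · exact ⟨(hue r).trans hur, (hHe r).trans hHr⟩
  refine ⟨2 * K, by positivity, fun x y => ?_⟩
  obtain ⟨x', hx', hux, hHx⟩ := hred x
  obtain ⟨y', hy', huy, hHy⟩ := hred y
  rw [← hux, ← hHx, ← huy, ← hHy]
  exact hfund x' hx' y' hy'

/-- A function controlled in the Hölder sense by a surjection onto `[-1, 1]` factors through it. -/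
theorem exists_holderClass_factor {K : ℝ} {u h : ℝ → ℝ} (hβ : 0 < β) (hβ1 : β < 1) (hK : 0 ≤ K)
    (hsurj : ∀ t ∈ Icc (-1 : ℝ) 1, ∃ x, u x = t) (hu : ∀ x, |u x| ≤ 1)
    (hh : ∀ x y, |h x - h y| ≤ K * |u x - u y| ^ β) :
    ∃ f : ℝ → ℝ, HolderClass β univ f ∧ ∀ x, f (u x) = h x := by
  have hle : (-1 : ℝ) ≤ 1 := by norm_num
  -- Any preimage will do, since `hh` makes `h` constant on the level sets of `u`. Clamping to `[-1,
  -- 1]` is `1`-Lipschitz, so it extends `f` to the line without loss.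
  choose g hg using fun t : Icc (-1 : ℝ) 1 => hsurj t t.2
  have hhol : ∀ t v, |h (g (projIcc (-1) 1 hle t)) - h (g (projIcc (-1) 1 hle v))| ≤
      K * |t - v| ^ β := by
    intro t v
    refine (hh _ _).trans ?_
    rw [hg, hg]
    have := abs_projIcc_sub_projIcc hle (c := t) (d := v)
    gcongr
  refine ⟨fun t => h (g (projIcc (-1) 1 hle t)), ?_, fun x => ?_⟩
  · refine holderClass_of_lt_one (B := |h 0| + K * 2 ^ β) hβ1 ?_ (fun t => ?_) hhol
    · rw [continuous_iff_continuousAt]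
      intro t
      rw [ContinuousAt, tendsto_iff_dist_tendsto_zero]
      have hc : Continuous fun v : ℝ => K * |v - t| ^ β :=
        continuous_const.mul (Continuous.rpow_const (by fun_prop) fun _ => Or.inr hβ.le)
      have h0 := hc.tendsto t
      rw [sub_self, abs_zero, Real.zero_rpow hβ.ne', mul_zero] at h0
      exact squeeze_zero (fun _ => dist_nonneg) (fun v => by rw [Real.dist_eq]; exact hhol v t) h0
    · set x := g (projIcc (-1) 1 hle t)
      have h1 := hh x 0
      have h2 := abs_sub_abs_le_abs_sub (h x) (h 0)
      have h3 : |u x - u 0| ≤ 2 := (abs_sub _ _).trans (by linarith [hu x, hu 0])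
      have h4 : K * |u x - u 0| ^ β ≤ K * 2 ^ β := by gcongr
      linarith
  · have hmem : u x ∈ Icc (-1 : ℝ) 1 := abs_le.1 (hu x)
    have h1 := hh (g (projIcc (-1) 1 hle (u x))) x
    rw [hg, projIcc_of_mem hle hmem, sub_self, abs_zero, Real.zero_rpow hβ.ne', mul_zero] at h1
    simp only [projIcc_of_mem hle hmem]
    exact sub_eq_zero.1 (abs_nonpos_iff.1 h1)

end Nonlinearity

theorem proposition3p1 (s β : ℝ) (hβ0 : 0 < β) (hβ1 : β < 1)
    (hs0 : 0 < 2 * s) (hs1 : 2 * s ≤ 1 - β) :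
    ∃ u f : ℝ → ℝ,
      HolderClass (2 * s / (1 - β)) univ u ∧
      HolderClass β univ f ∧
      (∃ T : ℝ, 0 < T ∧ Function.Periodic u T) ∧
      (∀ x : ℝ, HasFracLaplacianAt s u x (f (u x))) ∧
      ∀ ε ρ : ℝ, 0 < ε → 0 < ρ →
        ¬ HolderClass (2 * s / (1 - β) + ε) (Icc (-ρ) ρ) u := by
  have hpi := Real.pi_pos
  have hβ' : 0 < 1 - β := by linarith
  have hs : 0 < s := by linarith
  set α := 2 * s / (1 - β) with hαdef
  have hα : 0 < α := div_pos hs0 hβ'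
  have hα1 : α ≤ 1 := (div_le_one hβ').2 hs1
  have hscale : 2 * s = α * (1 - β) := (div_mul_cancel₀ _ hβ'.ne').symm
  -- Strict because `β > 0`; the Hölder exponent of `u` thus exceeds the order of the operator.
  have hsα : 2 * s < α := by
    rw [hscale]
    exact mul_lt_of_lt_one_right hα (by linarith)
  have hcont := continuous_periodicProfile hα hα1
  obtain ⟨K, hK, hH⟩ := exists_holder_control_periodicProfile hα hα1 hs (by linarith) hsα hβ0
    (by linarith) hscale
  obtain ⟨f, hf, hfu⟩ := exists_holderClass_factor (u := periodicProfile α)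
    (h := fun x => fracLaplacianConst s * fracIntegral s (periodicProfile α) x)
    (K := |fracLaplacianConst s| * K) hβ0 hβ1 (by positivity) (fun t ht => by
      have himg := intermediate_value_Icc (by linarith : (0 : ℝ) ≤ Real.pi / 2)
        hcont.continuousOn
      have h1 : periodicProfile α (Real.pi / 2) = 1 := by
        have := periodicProfile_reflect α 0
        rwa [sub_zero, periodicProfile_zero hα, neg_neg] at this
      rw [periodicProfile_zero hα, h1] at himg
      obtain ⟨x, _, hx⟩ := himg ht
      exact ⟨x, hx⟩) (abs_periodicProfile_le_one hα) (fun x y => by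
      rw [← mul_sub, abs_mul, mul_assoc]
      exact mul_le_mul_of_nonneg_left (hH x y) (abs_nonneg _))
  refine ⟨periodicProfile α, f, holderClass_periodicProfile hα hα1, hf,
    ⟨Real.pi, hpi, periodicProfile_periodic α⟩, fun x => ?_,
    fun ε ρ hε hρ => not_holderClass_periodicProfile hα hα1 hε hρ⟩
  rw [hfu]
  exact hasFracLaplacianAt_of_holder hs hsα hcont (abs_periodicProfile_sub_le hα hα1) x
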